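/- Fix $\Lambda>0$ and let $\Omega_\Lambda=(-\infty,-\Lambda)\cup(\Lambda,\infty)$. Let $AC^2(\overline{\Omega_\Lambda})$ be the set of functions $u$ on $\overline{\Omega_\Lambda}$ that are differentiable there (one-sidedly at $\pm\Lambda$), such that $u$ and $u'$ are absolutely continuous on every compact interval contained in $\overline{\Omega_\Lambda}$ and $u''\in L^2(\Omega_\Lambda)$; for $\psi\in L^2(\Omega_\Lambda)$ with a representative in $AC^2(\overline{\Omega_\Lambda})$, the values $\psi(\pm\Lambda),\psi'(\pm\Lambda)$ are those of this representative. Let $H_{00}=-d^2/dx^2$ on $C_0^\infty(\Omega_\Lambda)$, let $H_0=\overline{H_{00}}$ be its closure in $L^2(\Omega_\Lambda)$ and $H_0^*$ the adjoint of $H_0$. A self-adjoint extension of $H_0$ is an operator $B=B^*$ with $H_0\subset B$; equality of operators includes equality of domains. Let $\alpha_1,\alpha_2,\alpha_3,\alpha_4\in\mathbb C$ satisfy $\alpha_1\overline{\alpha_4}-\overline{\alpha_2}\,\alpha_3=1$ and $\alpha_1\overline{\alpha_3},\ \alpha_2\overline{\alpha_4}\in\mathbb R$. (i) Let $H_{\vec\alpha}=-d^2/dx^2$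 with domain the set of all $\psi\in D(H_0^*)$ (with a representative in $AC^2(\overline{\Omega_\Lambda})$) such that $$\psi(\Lambda)=\alpha_1\psi(-\Lambda)+\alpha_2\psi'(-\Lambda),\qquad \psi'(\Lambda)=\alpha_3\psi(-\Lambda)+\alpha_4\psi'(-\Lambda).$$ Then $H_{\vec\alpha}$ is a self-adjoint extension of $H_0$. (ii) Let $N=2^{1/4}e^{\Lambda/\sqrt2}$ and define on $\Omega_\Lambda$ the functions $R_\pm(x)=Ne^{(-1\pm i)x/\sqrt2}$ for $x>\Lambda$, $R_\pm(x)=0$ for $x<-\Lambda$, and $L_\pm(x)=Ne^{(1\mp i)x/\sqrt2}$ for $x<-\Lambda$, $L_\pm(x)=0$ for $x>\Lambda$. Suppose in addition that $\vec\alpha$ solves the system $$F(\alpha_1,\alpha_2)=0=F(\alpha_3,\alpha_4),$$ $$\alpha_1+\alpha_2e^{-i\pi/4}=(\alpha_3+\alpha_4e^{-i\pi/4})e^{i3\pi/4},\qquad \alpha_1+\alpha_2e^{i\pi/4}=(\alpha_3+\alpha_4e^{i\pi/4})e^{-i3\pi/4},$$ where either $F(z_1,z_2)=|z_1|^2+\sqrt2\,z_1z_2+|z_2|^2-1$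 or $F(z_1,z_2)=|z_1|^2+\sqrt2\,z_1\overline{z_2}+|z_2|^2-1$. Put $$\gamma_\to=(\alpha_1+\alpha_2e^{-i\pi/4})e^{i\sqrt2\Lambda},\qquad \gamma_\leftarrow=(\alpha_1+\alpha_2e^{i\pi/4})^{-1}e^{i\sqrt2\Lambda}.$$ Then also $$\gamma_\to=(\alpha_3+\alpha_4e^{-i\pi/4})e^{i\{\sqrt2\Lambda+3\pi/4\}},\qquad \gamma_\leftarrow=(\alpha_3+\alpha_4e^{i\pi/4})^{-1}e^{i\{\sqrt2\Lambda+3\pi/4\}},$$ and $|\gamma_\to|=|\gamma_\leftarrow|=1$. Let $H_\gamma=-d^2/dx^2$ with domain $$D(H_\gamma)=\{\psi_0+c_L(L_++\gamma_\to R_-)+c_R(R_++\gamma_\leftarrow L_-)\ :\ \psi_0\in D(H_0),\ c_L,c_R\in\mathbb C\}$$ (every element of which has a representative in $AC^2(\overline{\Omega_\Lambda})$). Then $H_\gamma$ is a self-adjoint extension of $H_0$, and $H_{\vec\alpha}=H_\gamma$. -/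

import Mathlib

open MeasureTheory Set Filter
open scoped ComplexConjugate ENNReal

namespace Junction

noncomputable section

/-! ### The line with the junction `[-Λ, Λ]` removed -/

/-- `Ω_Λ = (-∞, -Λ) ∪ (Λ, ∞)`. -/
def region (Λ : ℝ) : Set ℝ := Iio (-Λ) ∪ Ioi Λ

/-- The closure `(-∞, -Λ] ∪ [Λ, ∞)` of `Ω_Λ`. -/
def closedRegion (Λ : ℝ) : Set ℝ := Iic (-Λ) ∪ Ici Λ

/-- Lebesgue measure on `Ω_Λ`. -/
abbrev regionMeasure (Λ : ℝ) : Measure ℝ := volume.restrict (region Λ)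

/-- The Hilbert space `L²(Ω_Λ)`. -/
abbrev L2 (Λ : ℝ) : Type := Lp ℂ 2 (regionMeasure Λ)

/-! ### Absolutely continuous functions -/

/-- Absolute continuity on the closed region: absolute continuity on every compact interval that is
contained in it. -/
def LocAC (Λ : ℝ) (f : ℝ → ℂ) : Prop :=
  ∀ a b : ℝ, a ≤ b → Icc a b ⊆ closedRegion Λ → AbsolutelyContinuousOnInterval f a b

/-- The derivative relative to the closed region: the usual derivative at interior points, the
one-sided derivative at `-Λ` and at `Λ`. -/
def D (Λ : ℝ) (f : ℝ → ℂ) : ℝ → ℂ := derivWithin f (closedRegion Λ)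

/-- The class `AC²`: `u` is absolutely continuous and differentiable, `u'` is absolutely continuous,
and `u''` (which exists almost everywhere) is square integrable. -/
structure IsAC2 (Λ : ℝ) (u : ℝ → ℂ) : Prop where
  ac : LocAC Λ u
  diff : ∀ x ∈ closedRegion Λ, DifferentiableWithinAt ℝ u (closedRegion Λ) x
  ac_deriv : LocAC Λ (D Λ u)
  memLp_deriv2 : MemLp (D Λ (D Λ u)) 2 (regionMeasure Λ)

/-! #### Facts used in the construction of the operators -/

theorem isOpen_region (Λ : ℝ) : IsOpen (region Λ) := isOpen_Iio.union isOpen_Ioi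

theorem region_subset (Λ : ℝ) : region Λ ⊆ closedRegion Λ :=
  union_subset_union Iio_subset_Iic_self Ioi_subset_Ici_self

theorem closedRegion_mem_nhds {Λ x : ℝ} (hx : x ∈ region Λ) : closedRegion Λ ∈ nhds x :=
  Filter.mem_of_superset ((isOpen_region Λ).mem_nhds hx) (region_subset Λ)

theorem ae_mem_region (Λ : ℝ) : ∀ᵐ x ∂(regionMeasure Λ), x ∈ region Λ :=
  ae_restrict_mem (isOpen_region Λ).measurableSet

theorem D_eq_deriv {Λ x : ℝ} (f : ℝ → ℂ) (hx : x ∈ region Λ) : D Λ f x = deriv f x :=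
  derivWithin_of_mem_nhds (closedRegion_mem_nhds hx)

theorem LocAC.congr {Λ : ℝ} {f g : ℝ → ℂ} (hf : LocAC Λ f) (h : EqOn f g (closedRegion Λ)) :
    LocAC Λ g := by
  intro a b hab hs
  have hf' := hf a b hab hs
  rw [absolutelyContinuousOnInterval_iff] at hf' ⊢
  intro ε hε
  obtain ⟨δ, hδ, H⟩ := hf' ε hε
  refine ⟨δ, hδ, fun E hE hlt => ?_⟩
  have hlt' := H E hE hlt
  have hmem : ∀ i ∈ Finset.range E.1, (E.2 i).1 ∈ uIcc a b ∧ (E.2 i).2 ∈ uIcc a b := hE.1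
  rw [uIcc_of_le hab] at hmem
  refine lt_of_eq_of_lt (Finset.sum_congr rfl fun i hi => ?_) hlt'
  rw [h (hs (hmem i hi).1), h (hs (hmem i hi).2)]

theorem LocAC.add {Λ : ℝ} {f g : ℝ → ℂ} (hf : LocAC Λ f) (hg : LocAC Λ g) :
    LocAC Λ (fun x => f x + g x) :=
  fun a b hab hs => (hf a b hab hs).fun_add (hg a b hab hs)

theorem LocAC.smul {Λ : ℝ} {f : ℝ → ℂ} (c : ℂ) (hf : LocAC Λ f) :
    LocAC Λ (fun x => c * f x) :=
  fun a b hab hs => (hf a b hab hs).const_smul c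

theorem LocAC.ae_differentiableAt {Λ : ℝ} {f : ℝ → ℂ} (hf : LocAC Λ f) :
    ∀ᵐ x ∂(regionMeasure Λ), DifferentiableAt ℝ f x := by
  have key : ∀ s : Set ℝ, s.OrdConnected → s ⊆ closedRegion Λ →
      ∀ᵐ x : ℝ, x ∈ s → DifferentiableWithinAt ℝ f s x := by
    intro s hs hsub
    apply LocallyBoundedVariationOn.ae_differentiableWithinAt_of_mem
    intro a b ha hb
    rcases le_total a b with hab | hab
    · have h1 := (hf a b hab ((hs.out ha hb).trans hsub)).boundedVariationOn
      rw [uIcc_of_le hab] at h1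
      exact h1.mono inter_subset_right
    · have hss : (s ∩ Icc a b).Subsingleton := fun x hx y hy => by
        have h1 := hx.2
        have h2 := hy.2
        simp only [mem_Icc] at h1 h2
        linarith [h1.1, h1.2, h2.1, h2.2]
      rw [BoundedVariationOn, eVariationOn.subsingleton f hss]
      exact ENNReal.zero_ne_top
  have h1 := key (Iic (-Λ)) ordConnected_Iic subset_union_left
  have h2 := key (Ici Λ) ordConnected_Ici subset_union_right
  filter_upwards [ae_mem_region Λ, ae_restrict_of_ae h1, ae_restrict_of_ae h2] with x hx h1 h2
  rcases hx with hx | hx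
  · exact (h1 (Iio_subset_Iic_self hx)).differentiableAt (Iic_mem_nhds hx)
  · exact (h2 (Ioi_subset_Ici_self hx)).differentiableAt (Ici_mem_nhds hx)

theorem LocAC.continuousOn {Λ : ℝ} {f : ℝ → ℂ} (hf : LocAC Λ f) : ContinuousOn f (region Λ) := by
  intro x hx
  obtain ⟨ε, hε, hball⟩ := Metric.isOpen_iff.1 (isOpen_region Λ) x hx
  have hsub : Icc (x - ε / 2) (x + ε / 2) ⊆ region Λ := fun y hy => hball (by
    rw [Metric.mem_ball, Real.dist_eq, abs_lt]; constructor <;> linarith [hy.1, hy.2])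
  have h := (hf _ _ (by linarith) (hsub.trans (region_subset Λ))).continuousOn
  rw [uIcc_of_le (by linarith)] at h
  exact (h.continuousAt (Icc_mem_nhds (by linarith) (by linarith))).continuousWithinAt

theorem IsAC2.D_add {Λ : ℝ} {u v : ℝ → ℂ} (hu : IsAC2 Λ u) (hv : IsAC2 Λ v) :
    EqOn (fun x => D Λ u x + D Λ v x) (D Λ (fun x => u x + v x)) (closedRegion Λ) :=
  fun x hx => (derivWithin_fun_add (hu.diff x hx) (hv.diff x hx)).symm

theorem IsAC2.D_smul {Λ : ℝ} {u : ℝ → ℂ} (c : ℂ) (hu : IsAC2 Λ u) :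
    EqOn (fun x => c * D Λ u x) (D Λ (fun x => c * u x)) (closedRegion Λ) :=
  fun x hx => (derivWithin_const_mul c (hu.diff x hx)).symm

theorem IsAC2.D2_add {Λ : ℝ} {u v : ℝ → ℂ} (hu : IsAC2 Λ u) (hv : IsAC2 Λ v) :
    (fun x => D Λ (D Λ u) x + D Λ (D Λ v) x) =ᵐ[regionMeasure Λ]
      D Λ (D Λ (fun x => u x + v x)) := by
  filter_upwards [ae_mem_region Λ, hu.ac_deriv.ae_differentiableAt,
    hv.ac_deriv.ae_differentiableAt] with x hx h1 h2
  have h3 := derivWithin_congr (hu.D_add hv) (hu.D_add hv (region_subset Λ hx))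
  exact ((derivWithin_fun_add h1.differentiableWithinAt h2.differentiableWithinAt).symm.trans h3)

theorem IsAC2.D2_smul {Λ : ℝ} {u : ℝ → ℂ} (c : ℂ) (hu : IsAC2 Λ u) :
    (fun x => c * D Λ (D Λ u) x) =ᵐ[regionMeasure Λ] D Λ (D Λ (fun x => c * u x)) := by
  filter_upwards [ae_mem_region Λ, hu.ac_deriv.ae_differentiableAt] with x hx h1
  have h3 := derivWithin_congr (hu.D_smul c) (hu.D_smul c (region_subset Λ hx))
  exact ((derivWithin_const_mul c h1.differentiableWithinAt).symm.trans h3)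

theorem IsAC2.add {Λ : ℝ} {u v : ℝ → ℂ} (hu : IsAC2 Λ u) (hv : IsAC2 Λ v) :
    IsAC2 Λ (fun x => u x + v x) where
  ac := hu.ac.add hv.ac
  diff x hx := (hu.diff x hx).fun_add (hv.diff x hx)
  ac_deriv := (hu.ac_deriv.add hv.ac_deriv).congr (hu.D_add hv)
  memLp_deriv2 := (hu.memLp_deriv2.add hv.memLp_deriv2).ae_eq (hu.D2_add hv)

theorem IsAC2.smul {Λ : ℝ} {u : ℝ → ℂ} (c : ℂ) (hu : IsAC2 Λ u) :
    IsAC2 Λ (fun x => c * u x) where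
  ac := hu.ac.smul c
  diff x hx := (hu.diff x hx).const_mul c
  ac_deriv := (hu.ac_deriv.smul c).congr (hu.D_smul c)
  memLp_deriv2 := (hu.memLp_deriv2.const_mul c).ae_eq (hu.D2_smul c)

theorem D_zero (Λ : ℝ) : D Λ (fun _ => 0) = fun _ => 0 := by
  funext x; simp [D]

theorem IsAC2.zero (Λ : ℝ) : IsAC2 Λ (fun _ => 0) where
  ac := fun _ _ _ _ => contDiffOn_const.absolutelyContinuousOnInterval
  diff _ _ := differentiableWithinAt_const _
  ac_deriv := by
    rw [D_zero]; exact fun _ _ _ _ => contDiffOn_const.absolutelyContinuousOnInterval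
  memLp_deriv2 := by rw [D_zero, D_zero]; exact MemLp.zero

/-- Two `AC²` representatives of the same class agree on `Ω_Λ`. -/
theorem IsAC2.eqOn_of_ae {Λ : ℝ} {u v : ℝ → ℂ} (hu : IsAC2 Λ u) (hv : IsAC2 Λ v)
    (h : u =ᵐ[regionMeasure Λ] v) : EqOn u v (region Λ) :=
  Measure.eqOn_open_of_ae_eq h (isOpen_region Λ) hu.ac.continuousOn hv.ac.continuousOn

theorem eqOn_D {Λ : ℝ} {u v : ℝ → ℂ} (h : EqOn u v (region Λ)) :
    EqOn (D Λ u) (D Λ v) (region Λ) := by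
  intro x hx
  rw [D_eq_deriv u hx, D_eq_deriv v hx]
  exact (h.eventuallyEq_of_mem ((isOpen_region Λ).mem_nhds hx)).deriv_eq

theorem IsAC2.D2_ae_eq {Λ : ℝ} {u v : ℝ → ℂ} (hu : IsAC2 Λ u) (hv : IsAC2 Λ v)
    (h : u =ᵐ[regionMeasure Λ] v) : D Λ (D Λ u) =ᵐ[regionMeasure Λ] D Λ (D Λ v) := by
  filter_upwards [ae_mem_region Λ] with x hx using eqOn_D (eqOn_D (hu.eqOn_of_ae hv h)) hx

/-! ### The differential operator `-d²/dx²` -/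

/-- The classes in `L²(Ω_Λ)` with an `AC²` representative. -/
def maxDomain (Λ : ℝ) : Submodule ℂ (L2 Λ) where
  carrier := {ψ | ∃ u : ℝ → ℂ, IsAC2 Λ u ∧ ψ =ᵐ[regionMeasure Λ] u}
  zero_mem' := ⟨fun _ => 0, IsAC2.zero Λ, Lp.coeFn_zero ℂ 2 (regionMeasure Λ)⟩
  add_mem' := by
    rintro ψ φ ⟨u, hu, hψ⟩ ⟨v, hv, hφ⟩
    exact ⟨_, hu.add hv, (Lp.coeFn_add ψ φ).trans (hψ.add hφ)⟩
  smul_mem' := by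
    rintro c ψ ⟨u, hu, hψ⟩
    exact ⟨_, hu.smul c, (Lp.coeFn_smul c ψ).trans (hψ.const_smul c)⟩

/-- `-u''` for an `AC²` representative `u` of `ψ`. -/
def negDeriv2 (Λ : ℝ) (ψ : maxDomain Λ) : L2 Λ :=
  (ψ.2.choose_spec.1.memLp_deriv2.neg).toLp (-(D Λ (D Λ ψ.2.choose)))

theorem negDeriv2_ae_eq {Λ : ℝ} (ψ : maxDomain Λ) {u : ℝ → ℂ} (hu : IsAC2 Λ u)
    (hψ : (ψ : L2 Λ) =ᵐ[regionMeasure Λ] u) :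
    negDeriv2 Λ ψ =ᵐ[regionMeasure Λ] fun x => -(D Λ (D Λ u) x) := by
  have h := ψ.2.choose_spec
  refine (MemLp.coeFn_toLp h.1.memLp_deriv2.neg).trans ?_
  exact (h.1.D2_ae_eq hu (h.2.symm.trans hψ)).neg

/-- The operator `-d²/dx²` on all classes in `L²(Ω_Λ)` with an `AC²` representative. All operators
below are restrictions of it. -/
def negLaplacian (Λ : ℝ) : L2 Λ →ₗ.[ℂ] L2 Λ where
  domain := maxDomain Λ
  toFun :=
    { toFun := negDeriv2 Λ
      map_add' := by
        intro ψ φ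
        obtain ⟨u, hu, hψ⟩ := ψ.2
        obtain ⟨v, hv, hφ⟩ := φ.2
        apply Lp.ext
        have h1 := negDeriv2_ae_eq (ψ + φ) (hu.add hv)
          ((Lp.coeFn_add (ψ : L2 Λ) φ).trans (hψ.add hφ))
        filter_upwards [h1, negDeriv2_ae_eq ψ hu hψ, negDeriv2_ae_eq φ hv hφ, hu.D2_add hv,
          Lp.coeFn_add (negDeriv2 Λ ψ) (negDeriv2 Λ φ)] with x h1 h2 h3 h4 h5
        rw [h5, h1, Pi.add_apply, h2, h3, ← h4]
        ring
      map_smul' := by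
        intro c ψ
        obtain ⟨u, hu, hψ⟩ := ψ.2
        apply Lp.ext
        have h1 := negDeriv2_ae_eq (c • ψ) (hu.smul c)
          ((Lp.coeFn_smul c (ψ : L2 Λ)).trans (hψ.const_smul c))
        filter_upwards [h1, negDeriv2_ae_eq ψ hu hψ, hu.D2_smul c,
          Lp.coeFn_smul c (negDeriv2 Λ ψ)] with x h1 h2 h4 h5
        simp only [RingHom.id_apply]
        rw [h5, h1, Pi.smul_apply, h2, ← h4, smul_eq_mul]
        ring }

/-! ### The minimal operator -/

/-- The subspace `C₀^∞(Ω_Λ)` of `L²(Ω_Λ)`. -/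
def testSpace (Λ : ℝ) : Submodule ℂ (L2 Λ) where
  carrier := {ψ | ∃ u : ℝ → ℂ, ContDiff ℝ (⊤ : ℕ∞) u ∧ HasCompactSupport u ∧
    tsupport u ⊆ region Λ ∧ ψ =ᵐ[regionMeasure Λ] u}
  zero_mem' := ⟨fun _ => 0, contDiff_const, HasCompactSupport.zero,
    by simp [tsupport], Lp.coeFn_zero ℂ 2 (regionMeasure Λ)⟩
  add_mem' := by
    rintro ψ φ ⟨u, hu, hu', hus, hψ⟩ ⟨v, hv, hv', hvs, hφ⟩
    exact ⟨u + v, hu.add hv, hu'.add hv', (tsupport_add u v).trans (union_subset hus hvs),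
      (Lp.coeFn_add ψ φ).trans (hψ.add hφ)⟩
  smul_mem' := by
    rintro c ψ ⟨u, hu, hu', hus, hψ⟩
    refine ⟨c • u, hu.const_smul c, ?_, ?_, (Lp.coeFn_smul c ψ).trans (hψ.const_smul c)⟩
    · exact hu'.mono (Function.support_const_smul_subset c u)
    · exact (closure_mono (Function.support_const_smul_subset c u)).trans hus

/-- Test functions lie in the domain of `negLaplacian`, so that `H00` has domain `C₀^∞(Ω_Λ)`. -/
theorem testSpace_le_maxDomain (Λ : ℝ) : testSpace Λ ≤ maxDomain Λ := by
  rintro ψ ⟨u, hu, hu', hus, hψ⟩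
  have hdiff : ∀ {f : ℝ → ℂ}, ContDiff ℝ (⊤ : ℕ∞) f → tsupport f ⊆ region Λ →
      EqOn (deriv f) (D Λ f) (closedRegion Λ) := by
    intro f hf hfs x hx
    by_cases hxr : x ∈ region Λ
    · exact (D_eq_deriv f hxr).symm
    · have h0 : f =ᶠ[nhds x] fun _ => 0 :=
        notMem_tsupport_iff_eventuallyEq.1 fun h => hxr (hfs h)
      rw [h0.deriv_eq, D, (h0.filter_mono nhdsWithin_le_nhds).derivWithin_eq h0.eq_of_nhds]
      simp
  have hd1 : ContDiff ℝ (⊤ : ℕ∞) (deriv u) := by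
    have := hu.iterate_deriv 1
    simpa using this
  have hd2 : ContDiff ℝ (⊤ : ℕ∞) (deriv (deriv u)) := by
    have := hu.iterate_deriv 2
    simpa using this
  have hac : ∀ {f : ℝ → ℂ}, ContDiff ℝ (⊤ : ℕ∞) f → LocAC Λ f := fun hf a b _ _ =>
    (hf.of_le (by exact_mod_cast le_top)).contDiffOn.absolutelyContinuousOnInterval
  refine ⟨u, ⟨hac hu, fun x _ => ?_, (hac hd1).congr (hdiff hu hus), ?_⟩, hψ⟩
  · exact (hu.differentiable (by simp)).differentiableAt.differentiableWithinAt
  · have h2 : MemLp (deriv (deriv u)) 2 (regionMeasure Λ) :=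
      hd2.continuous.memLp_of_hasCompactSupport hu'.deriv.deriv
    refine h2.ae_eq ?_
    filter_upwards [ae_mem_region Λ] with x hx
    have h3 : EqOn (deriv u) (D Λ u) (region Λ) := (hdiff hu hus).mono (region_subset Λ)
    rw [← eqOn_D h3 hx, D_eq_deriv _ hx]

/-- `H₀₀ = -d²/dx²` with domain `C₀^∞(Ω_Λ)`. -/
def H00 (Λ : ℝ) : L2 Λ →ₗ.[ℂ] L2 Λ := (negLaplacian Λ).domRestrict (testSpace Λ)

/-- `H₀`, the closure of `H₀₀`. -/
def H0 (Λ : ℝ) : L2 Λ →ₗ.[ℂ] L2 Λ := (H00 Λ).closure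

/-- `B` is a self-adjoint extension of `A`: `A ⊆ B` and `B† = B`. -/
def IsSelfAdjointExtension {Λ : ℝ} (A B : L2 Λ →ₗ.[ℂ] L2 Λ) : Prop :=
  A ≤ B ∧ IsSelfAdjoint B

/-! ### Coupled boundary conditions -/

/-- The class `𝒜`. -/
def ClassA (α₁ α₂ α₃ α₄ : ℂ) : Prop :=
  α₁ * conj α₄ - conj α₂ * α₃ = 1 ∧ (α₁ * conj α₃).im = 0 ∧ (α₂ * conj α₄).im = 0

/-- The boundary condition `BC(α)`. -/
def BC (Λ : ℝ) (α₁ α₂ α₃ α₄ : ℂ) (u : ℝ → ℂ) : Prop :=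
  u Λ = α₁ * u (-Λ) + α₂ * D Λ u (-Λ) ∧ D Λ u Λ = α₃ * u (-Λ) + α₄ * D Λ u (-Λ)

theorem neg_mem_closedRegion (Λ : ℝ) : -Λ ∈ closedRegion Λ := Or.inl self_mem_Iic

theorem mem_closedRegion (Λ : ℝ) : Λ ∈ closedRegion Λ := Or.inr self_mem_Ici

/-- The `ψ` in `D(H₀*)` that satisfy `BC(α)`. Boundary values are those of an `AC²` representative
of `ψ`. -/
def alphaDomain (Λ : ℝ) (α₁ α₂ α₃ α₄ : ℂ) : Submodule ℂ (L2 Λ) where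
  carrier := {ψ | ψ ∈ (H0 Λ).adjoint.domain ∧
    ∃ u : ℝ → ℂ, IsAC2 Λ u ∧ ψ =ᵐ[regionMeasure Λ] u ∧ BC Λ α₁ α₂ α₃ α₄ u}
  zero_mem' := ⟨zero_mem _, fun _ => 0, IsAC2.zero Λ, Lp.coeFn_zero ℂ 2 (regionMeasure Λ),
    by simp [BC, D_zero]⟩
  add_mem' := by
    rintro ψ φ ⟨hψ0, u, hu, hψ, h1, h2⟩ ⟨hφ0, v, hv, hφ, h3, h4⟩
    refine ⟨add_mem hψ0 hφ0, _, hu.add hv, (Lp.coeFn_add ψ φ).trans (hψ.add hφ), ?_⟩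
    have e1 := hu.D_add hv (neg_mem_closedRegion Λ)
    have e2 := hu.D_add hv (mem_closedRegion Λ)
    simp only at e1 e2
    constructor
    · rw [← e1]; simp only; rw [h1, h3]; ring
    · rw [← e1, ← e2, h2, h4]; ring
  smul_mem' := by
    rintro c ψ ⟨hψ0, u, hu, hψ, h1, h2⟩
    refine ⟨Submodule.smul_mem _ c hψ0, _, hu.smul c,
      (Lp.coeFn_smul c ψ).trans (hψ.const_smul c), ?_⟩
    have e1 := hu.D_smul c (neg_mem_closedRegion Λ)
    have e2 := hu.D_smul c (mem_closedRegion Λ)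
    simp only at e1 e2
    constructor
    · rw [← e1]; simp only; rw [h1]; ring
    · rw [← e1, ← e2, h2]; ring

/-- `H_α = -d²/dx²` on `alphaDomain`. -/
def Halpha (Λ : ℝ) (α₁ α₂ α₃ α₄ : ℂ) : L2 Λ →ₗ.[ℂ] L2 Λ :=
  (negLaplacian Λ).domRestrict (alphaDomain Λ α₁ α₂ α₃ α₄)

/-- The function `F` of the system `𝒮`, in its literal form. -/
def F (z₁ z₂ : ℂ) : ℂ :=
  (‖z₁‖ : ℂ) ^ 2 + (√2 : ℝ) * z₁ * z₂ + (‖z₂‖ : ℂ) ^ 2 - 1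

/-- The sesquilinear variant of `F`, with `z₁ z₂*` in place of `z₁ z₂`. -/
def Fconj (z₁ z₂ : ℂ) : ℂ :=
  (‖z₁‖ : ℂ) ^ 2 + (√2 : ℝ) * z₁ * conj z₂ + (‖z₂‖ : ℂ) ^ 2 - 1

/-- `phase t = e^{it}`. -/
def phase (t : ℝ) : ℂ := Complex.exp (t * Complex.I)

/-- `α` solves the system `𝒮` formed with the function `G`. -/
def SystemS (G : ℂ → ℂ → ℂ) (α₁ α₂ α₃ α₄ : ℂ) : Prop :=
  (G α₁ α₂ = 0 ∧ G α₃ α₄ = 0) ∧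
  α₁ + α₂ * phase (-(Real.pi / 4)) =
    (α₃ + α₄ * phase (-(Real.pi / 4))) * phase (3 * Real.pi / 4) ∧
  α₁ + α₂ * phase (Real.pi / 4) =
    (α₃ + α₄ * phase (Real.pi / 4)) * phase (-(3 * Real.pi / 4))

/-! ### Deficiency vectors and the extension `H_γ` -/

/-- The normalisation factor `2^{1/4} e^{Λ/√2}`. -/
def normFactor (Λ : ℝ) : ℝ := (2 : ℝ) ^ (1 / 4 : ℝ) * Real.exp (Λ / √2)

/-- `R₊`. -/
def Rplus (Λ : ℝ) (x : ℝ) : ℂ :=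
  if Λ < x then normFactor Λ * Complex.exp ((-1 + Complex.I) * x / (√2 : ℝ)) else 0

/-- `R₋`. -/
def Rminus (Λ : ℝ) (x : ℝ) : ℂ :=
  if Λ < x then normFactor Λ * Complex.exp ((-1 - Complex.I) * x / (√2 : ℝ)) else 0

/-- `L₊`. -/
def Lplus (Λ : ℝ) (x : ℝ) : ℂ :=
  if x < -Λ then normFactor Λ * Complex.exp ((1 - Complex.I) * x / (√2 : ℝ)) else 0

/-- `L₋`. -/
def Lminus (Λ : ℝ) (x : ℝ) : ℂ :=
  if x < -Λ then normFactor Λ * Complex.exp ((1 + Complex.I) * x / (√2 : ℝ)) else 0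

/-- All `ψ₀ + c_L (L₊ + γ_→ R₋) + c_R (R₊ + γ_← L₋)` with `ψ₀ ∈ D(H₀)` and complex `c_L`, `c_R`. -/
def gammaDomain (Λ : ℝ) (γr γl : ℂ) : Submodule ℂ (L2 Λ) where
  carrier := {ψ | ∃ ψ₀ ∈ (H0 Λ).domain, ∃ cL cR : ℂ, ψ =ᵐ[regionMeasure Λ] fun x =>
    ψ₀ x + cL * (Lplus Λ x + γr * Rminus Λ x) + cR * (Rplus Λ x + γl * Lminus Λ x)}
  zero_mem' := ⟨0, zero_mem _, 0, 0, by simp⟩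
  add_mem' := by
    rintro ψ φ ⟨ψ₀, hψ₀, a, b, hψ⟩ ⟨φ₀, hφ₀, c, d, hφ⟩
    refine ⟨ψ₀ + φ₀, add_mem hψ₀ hφ₀, a + c, b + d, ?_⟩
    filter_upwards [hψ, hφ, Lp.coeFn_add ψ φ, Lp.coeFn_add ψ₀ φ₀] with x h1 h2 h3 h4
    rw [h3, h4, Pi.add_apply, Pi.add_apply, h1, h2]
    ring
  smul_mem' := by
    rintro k ψ ⟨ψ₀, hψ₀, a, b, hψ⟩
    refine ⟨k • ψ₀, Submodule.smul_mem _ k hψ₀, k * a, k * b, ?_⟩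
    filter_upwards [hψ, Lp.coeFn_smul k ψ, Lp.coeFn_smul k ψ₀] with x h1 h3 h4
    rw [h3, h4, Pi.smul_apply, Pi.smul_apply, h1, smul_eq_mul, smul_eq_mul]
    ring

/-- `H_γ = -d²/dx²` on `gammaDomain` with `γ = (γ_→, γ_←)`. -/
def Hgamma (Λ : ℝ) (γr γl : ℂ) : L2 Λ →ₗ.[ℂ] L2 Λ :=
  (negLaplacian Λ).domRestrict (gammaDomain Λ γr γl)

end

end Junction

namespace Junction

/-! ### Absolutely continuous complex-valued functions -/

/-! Every operator here is the maximal operator `negLaplacian` or is obtained from a restriction of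
it, so the questions reduce to domains. An `AC²` function in `L²` decays at infinity together with
its derivative (`IsAC2.tendsto_zero`). Green's formula (`inner_negLaplacian_sub`) therefore measures
failure of symmetry by the boundary form at `-Λ` minus the one at `Λ`. By du Bois-Reymond's lemma,
weak solutions of `-u'' = χ` have `AC²` representatives (`mem_maxDomain_of_inner`), which makes the
maximal operator the adjoint of `H00`. Hence a restriction containing the test functions is
self-adjoint when its domain is its own annihilator for the boundary form
(`isSelfAdjoint_domRestrict`).

For (i), `ClassA` says that the matrix of the `α`'s, which carries data at `-Λ` to data at `Λ`,
preserves the boundary form. Its graph is then isotropic, and inverting the matrix shows that it is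
its own annihilator.

For (ii), the linear equations force `α₄ = α₁` and `α₃ = -√2 α₁ - α₂`. With `ClassA` this gives both
moduli the value one. The formulas for `γ` then say exactly that the two deficiency combinations
satisfy the boundary condition. Here `L₊`, `R₊` solve `-u'' = iu` and `L₋`, `R₋` solve `-u'' = -iu`.
The data of the combinations at `-Λ` span `ℂ²`, so subtracting a suitable combination from an
element of `alphaDomain` kills its data at `-Λ`, hence by the boundary condition also at `Λ`. What
remains lies in `D(H₀)` (`mem_H0_domain_of_zeroData`). The domains coincide, and self-adjointness of
`Hgamma` is inherited from `Halpha`. -/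

theorem _root_.AbsolutelyContinuousOnInterval.clm_comp {E F : Type*} [NormedAddCommGroup E]
    [NormedSpace ℝ E] [NormedAddCommGroup F] [NormedSpace ℝ F] (L : E →L[ℝ] F) {f : ℝ → E}
    {a b : ℝ} (hf : AbsolutelyContinuousOnInterval f a b) :
    AbsolutelyContinuousOnInterval (fun x => L (f x)) a b := by
  rw [absolutelyContinuousOnInterval_iff] at hf ⊢
  intro ε hε
  -- The `+ 1` keeps the divisor positive when `L = 0`.
  obtain ⟨δ, hδ, H⟩ := hf (ε / (‖L‖ + 1)) (by positivity)
  refine ⟨δ, hδ, fun E hE hlt => ?_⟩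
  have h1 := H E hE hlt
  rw [lt_div_iff₀ (by positivity)] at h1
  refine lt_of_le_of_lt ?_ h1
  rw [Finset.sum_mul]
  refine Finset.sum_le_sum fun i _ => ?_
  rw [dist_eq_norm, dist_eq_norm, ← map_sub, mul_comm]
  refine (L.le_opNorm _).trans ?_
  gcongr
  linarith

theorem _root_.AbsolutelyContinuousOnInterval.congr {E : Type*} [PseudoMetricSpace E]
    {f g : ℝ → E} {a b : ℝ} (hf : AbsolutelyContinuousOnInterval f a b)
    (h : EqOn f g (uIcc a b)) : AbsolutelyContinuousOnInterval g a b := by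
  rw [absolutelyContinuousOnInterval_iff] at hf ⊢
  intro ε hε
  obtain ⟨δ, hδ, H⟩ := hf ε hε
  refine ⟨δ, hδ, fun E hE hlt => lt_of_eq_of_lt (Finset.sum_congr rfl fun i hi => ?_) (H E hE hlt)⟩
  have hmem : ∀ i ∈ Finset.range E.1, (E.2 i).1 ∈ uIcc a b ∧ (E.2 i).2 ∈ uIcc a b := hE.1
  rw [h (hmem i hi).1, h (hmem i hi).2]

theorem _root_.AbsolutelyContinuousOnInterval.mul_complex {f g : ℝ → ℂ} {a b : ℝ}
    (hf : AbsolutelyContinuousOnInterval f a b) (hg : AbsolutelyContinuousOnInterval g a b) :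
    AbsolutelyContinuousOnInterval (fun x => f x * g x) a b :=
  hf.fun_smul hg

theorem _root_.AbsolutelyContinuousOnInterval.conj {f : ℝ → ℂ} {a b : ℝ}
    (hf : AbsolutelyContinuousOnInterval f a b) :
    AbsolutelyContinuousOnInterval (fun x => conj (f x)) a b :=
  hf.clm_comp (Complex.conjCLE : ℂ →L[ℝ] ℂ)

theorem intervalIntegral_eq_re_add_im {f : ℝ → ℂ} {a b : ℝ}
    (hf : IntervalIntegrable f volume a b) :
    ∫ x in a..b, f x =
      ((∫ x in a..b, (f x).re : ℝ) : ℂ) + ((∫ x in a..b, (f x).im : ℝ) : ℂ) * Complex.I := by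
  have h1 := Complex.reCLM.intervalIntegral_comp_comm hf
  have h2 := Complex.imCLM.intervalIntegral_comp_comm hf
  simp only [Complex.reCLM_apply, Complex.imCLM_apply] at h1 h2
  rw [h1, h2, Complex.re_add_im]

theorem intervalIntegrable_of_re_im {f : ℝ → ℂ} {a b : ℝ}
    (h1 : IntervalIntegrable (fun x => (f x).re) volume a b)
    (h2 : IntervalIntegrable (fun x => (f x).im) volume a b) :
    IntervalIntegrable f volume a b := by
  have h : ∀ {g : ℝ → ℝ}, IntervalIntegrable g volume a b →
      IntervalIntegrable (fun x => (g x : ℂ)) volume a b := fun hg =>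
    ⟨hg.1.ofReal, hg.2.ofReal⟩
  refine ((h h1).add ((h h2).mul_const Complex.I)).congr ?_
  exact fun x _ => Complex.re_add_im (f x)

theorem absolutelyContinuousOnInterval_integral {f : ℝ → ℂ} {a b c : ℝ}
    (hf : IntervalIntegrable f volume a b) (hc : c ∈ uIcc a b) :
    AbsolutelyContinuousOnInterval (fun x => ∫ t in c..x, f t) a b := by
  have h1 : IntervalIntegrable (fun x => (f x).re) volume a b := ⟨hf.1.re, hf.2.re⟩
  have h2 : IntervalIntegrable (fun x => (f x).im) volume a b := ⟨hf.1.im, hf.2.im⟩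
  have A := (h1.absolutelyContinuousOnInterval_intervalIntegral hc).clm_comp Complex.ofRealCLM
  have B := ((h2.absolutelyContinuousOnInterval_intervalIntegral hc).clm_comp
    Complex.ofRealCLM).const_smul Complex.I
  refine (A.fun_add B).congr fun x hx => ?_
  simp only
  rw [intervalIntegral_eq_re_add_im (hf.mono_set (uIcc_subset_uIcc hc hx))]
  simp [mul_comm]

/-- The fundamental theorem of calculus for complex-valued absolutely continuous functions. -/
theorem _root_.AbsolutelyContinuousOnInterval.integral_eq_sub {f f' : ℝ → ℂ} {a b : ℝ}
    (hf : AbsolutelyContinuousOnInterval f a b)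
    (hd : ∀ᵐ x, x ∈ uIcc a b → HasDerivAt f (f' x) x) :
    IntervalIntegrable f' volume a b ∧ ∫ x in a..b, f' x = f b - f a := by
  -- Real and imaginary parts are absolutely continuous real functions, so their derivatives are
  -- integrable and recover the increments.
  have h1 := hf.clm_comp Complex.reCLM
  have h2 := hf.clm_comp Complex.imCLM
  have d1 : ∀ᵐ x, x ∈ uIoc a b → deriv (fun x => Complex.reCLM (f x)) x = (f' x).re := by
    filter_upwards [hd] with x hx hxm
    exact (Complex.reCLM.hasFDerivAt.comp_hasDerivAt x (hx (uIoc_subset_uIcc hxm))).deriv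
  have d2 : ∀ᵐ x, x ∈ uIoc a b → deriv (fun x => Complex.imCLM (f x)) x = (f' x).im := by
    filter_upwards [hd] with x hx hxm
    exact (Complex.imCLM.hasFDerivAt.comp_hasDerivAt x (hx (uIoc_subset_uIcc hxm))).deriv
  have i1 : IntervalIntegrable (fun x => (f' x).re) volume a b :=
    h1.intervalIntegrable_deriv.congr_ae ((ae_restrict_iff' measurableSet_uIoc).2 d1)
  have i2 : IntervalIntegrable (fun x => (f' x).im) volume a b :=
    h2.intervalIntegrable_deriv.congr_ae ((ae_restrict_iff' measurableSet_uIoc).2 d2)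
  have hi := intervalIntegrable_of_re_im i1 i2
  refine ⟨hi, ?_⟩
  rw [intervalIntegral_eq_re_add_im hi, ← intervalIntegral.integral_congr_ae d1,
    ← intervalIntegral.integral_congr_ae d2, h1.integral_deriv_eq_sub, h2.integral_deriv_eq_sub]
  apply Complex.ext <;> simp

/-- Lagrange's identity `∫ (a b'' - a'' b) = [a b' - a' b]`. -/
theorem lagrange_identity {a a' a'' b b' b'' : ℝ → ℂ} {x y : ℝ}
    (ha : AbsolutelyContinuousOnInterval a x y) (ha' : AbsolutelyContinuousOnInterval a' x y)
    (hb : AbsolutelyContinuousOnInterval b x y) (hb' : AbsolutelyContinuousOnInterval b' x y)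
    (da : ∀ᵐ t, t ∈ uIcc x y → HasDerivAt a (a' t) t ∧ HasDerivAt a' (a'' t) t)
    (db : ∀ᵐ t, t ∈ uIcc x y → HasDerivAt b (b' t) t ∧ HasDerivAt b' (b'' t) t) :
    ∫ t in x..y, (a t * b'' t - a'' t * b t) =
      (a y * b' y - a' y * b y) - (a x * b' x - a' x * b x) := by
  -- The integrand is the derivative of `a b' - a' b`, since the products `a' b'` cancel.
  refine (((ha.mul_complex hb').fun_sub (ha'.mul_complex hb)).integral_eq_sub ?_).2
  filter_upwards [da, db] with t h1 h2 ht
  refine (((h1 ht).1.fun_mul (h2 ht).2).fun_sub ((h1 ht).2.fun_mul (h2 ht).1)).congr_deriv ?_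
  ring

/-! ### Decay at infinity and Green's formula -/

theorem ae_mem_region_of_mem_closedRegion (Λ : ℝ) :
    ∀ᵐ x : ℝ, x ∈ closedRegion Λ → x ∈ region Λ := by
  have h : (({-Λ, Λ} : Set ℝ)ᶜ) ∈ ae (volume : Measure ℝ) :=
    compl_mem_ae_iff.2 ((Set.toFinite _).measure_zero _)
  filter_upwards [h] with x hx hxc
  simp only [mem_compl_iff, mem_insert_iff, mem_singleton_iff, not_or] at hx
  rcases hxc with h | h
  · exact Or.inl (lt_of_le_of_ne h hx.1)
  · exact Or.inr (lt_of_le_of_ne h (Ne.symm hx.2))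

theorem IsAC2.hasDerivAt {Λ : ℝ} {u : ℝ → ℂ} (hu : IsAC2 Λ u) {x : ℝ} (hx : x ∈ region Λ) :
    HasDerivAt u (D Λ u x) x := by
  have h := hu.diff x (region_subset Λ hx)
  rw [D_eq_deriv u hx]
  exact (h.differentiableAt (closedRegion_mem_nhds hx)).hasDerivAt

theorem IsAC2.ae_hasDerivAt {Λ : ℝ} {u : ℝ → ℂ} (hu : IsAC2 Λ u) :
    ∀ᵐ x : ℝ, x ∈ closedRegion Λ →
      HasDerivAt u (D Λ u x) x ∧ HasDerivAt (D Λ u) (D Λ (D Λ u) x) x := by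
  have h := (ae_restrict_iff' (isOpen_region Λ).measurableSet).1 hu.ac_deriv.ae_differentiableAt
  filter_upwards [h, ae_mem_region_of_mem_closedRegion Λ] with x h1 h2 hx
  refine ⟨hu.hasDerivAt (h2 hx), ?_⟩
  rw [D_eq_deriv _ (h2 hx)]
  exact (h1 (h2 hx)).hasDerivAt

theorem LocAC.uIcc {Λ : ℝ} {f : ℝ → ℂ} (hf : LocAC Λ f) {x y : ℝ}
    (h : uIcc x y ⊆ closedRegion Λ) : AbsolutelyContinuousOnInterval f x y := by
  rcases le_total x y with hxy | hxy
  · exact hf x y hxy (by rwa [uIcc_of_le hxy] at h)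
  · exact (hf y x hxy (by rwa [uIcc_of_ge hxy] at h)).symm

/-- Green's formula on a compact interval. -/
theorem IsAC2.lagrange {Λ : ℝ} {u v : ℝ → ℂ} (hu : IsAC2 Λ u) (hv : IsAC2 Λ v) {x y : ℝ}
    (h : uIcc x y ⊆ closedRegion Λ) :
    ∫ t in x..y, (conj (u t) * D Λ (D Λ v) t - conj (D Λ (D Λ u) t) * v t) =
      (conj (u y) * D Λ v y - conj (D Λ u y) * v y) -
        (conj (u x) * D Λ v x - conj (D Λ u x) * v x) := by
  refine lagrange_identity (hu.ac.uIcc h).conj (hu.ac_deriv.uIcc h).conj (hv.ac.uIcc h)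
    (hv.ac_deriv.uIcc h) ?_ ?_
  · filter_upwards [hu.ae_hasDerivAt] with t ht hm
    exact ⟨(ht (h hm)).1.star, (ht (h hm)).2.star⟩
  · filter_upwards [hv.ae_hasDerivAt] with t ht hm using ht (h hm)

/-- Dominated convergence: each fixed point eventually leaves the window, and `|h|` is the bound.
Assuming only `|x| → ∞` treats both ends of the line at once. -/
theorem tendsto_integral_sq_window {h : ℝ → ℝ} (hh : Integrable h) {l : Filter ℝ}
    [l.IsCountablyGenerated] (hl : Tendsto (fun x : ℝ => |x|) l atTop) :
    Tendsto (fun x => ∫ t, (Icc (x - 1) (x + 1)).indicator h t) l (nhds 0) := by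
  have := tendsto_integral_filter_of_dominated_convergence (μ := volume) (l := l)
    (F := fun x t => (Icc (x - 1) (x + 1)).indicator h t) (f := fun _ => (0 : ℝ))
    (fun t => ‖h t‖) (Eventually.of_forall fun x =>
      hh.aestronglyMeasurable.indicator measurableSet_Icc)
    (Eventually.of_forall fun x => Eventually.of_forall fun t => norm_indicator_le_norm_self _ _)
    hh.norm (Eventually.of_forall fun t => ?_)
  · simpa using this
  · refine tendsto_const_nhds.congr' ?_
    filter_upwards [hl.eventually_gt_atTop (|t| + 1)] with x hx
    rw [indicator_of_notMem]
    rintro ⟨h1, h2⟩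
    have : |x - t| ≤ 1 := abs_le.2 ⟨by linarith, by linarith⟩
    have := abs_add_le (x - t) t
    rw [sub_add_cancel] at this
    linarith

/-- The integral of an `L²` function over a window of length one tends to zero as the window
moves to infinity. -/
theorem tendsto_integral_norm_window {Λ : ℝ} {f : ℝ → ℂ} (hf : MemLp f 2 (regionMeasure Λ))
    {σ : ℝ} (hσ : |σ| = 1) {l : Filter ℝ} [l.IsCountablyGenerated]
    (hl : Tendsto (fun x : ℝ => |x|) l atTop)
    (hR : ∀ᶠ x in l, uIcc x (x + σ) ⊆ region Λ) :
    Tendsto (fun x => ∫ t in uIoc x (x + σ), ‖f t‖) l (nhds 0) := by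
  have hsq : Integrable ((region Λ).indicator fun t => ‖f t‖ ^ 2) :=
    (integrable_indicator_iff (isOpen_region Λ).measurableSet).2 (hf.integrable_norm_pow two_ne_zero)
  have hw := tendsto_integral_sq_window hsq hl
  rw [Metric.tendsto_nhds] at hw ⊢
  intro ε hε
  filter_upwards [hw (ε ^ 2) (by positivity), hR] with x hx hxR
  have hsub : uIoc x (x + σ) ⊆ region Λ := uIoc_subset_uIcc.trans hxR
  have hsub2 : uIoc x (x + σ) ⊆ Icc (x - 1) (x + 1) := by
    intro t ht
    rcases abs_eq (by norm_num) |>.1 hσ with rfl | rfl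
    · rw [uIoc_of_le (by linarith)] at ht; exact ⟨by linarith [ht.1], ht.2⟩
    · rw [uIoc_of_ge (by linarith)] at ht; exact ⟨by linarith [ht.1], by linarith [ht.2]⟩
  have hvol : volume.real (uIoc x (x + σ)) = 1 := by
    simp [Measure.real, hσ]
  have hfS : MemLp f 2 (volume.restrict (uIoc x (x + σ))) :=
    hf.mono_measure (Measure.restrict_mono hsub le_rfl)
  have : IsFiniteMeasure (volume.restrict (uIoc x (x + σ))) := ⟨by simp⟩
  have hint := (hfS.integrable (by norm_num)).norm
  have hint2 := hfS.integrable_norm_pow (by norm_num)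
  have h0 : 0 ≤ ∫ t in uIoc x (x + σ), ‖f t‖ := integral_nonneg fun _ => norm_nonneg _
  -- The inequality `‖f‖ ≤ ε/2 + ‖f‖²/(2ε)` plays the role of Cauchy-Schwarz: on a window of length
  -- one with `∫ ‖f‖² < ε²` the right side integrates to less than `ε`.
  have h1 : ∫ t in uIoc x (x + σ), ‖f t‖ ≤
      ∫ t in uIoc x (x + σ), (ε / 2 + ‖f t‖ ^ 2 / (2 * ε)) := by
    refine integral_mono hint ((integrable_const _).add (hint2.div_const _)) fun t => ?_
    have : ε / 2 + ‖f t‖ ^ 2 / (2 * ε) - ‖f t‖ = (ε - ‖f t‖) ^ 2 / (2 * ε) := by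
      field_simp; ring
    have h2 : 0 ≤ (ε - ‖f t‖) ^ 2 / (2 * ε) := by positivity
    simp only
    linarith
  rw [integral_add (integrable_const _) (hint2.div_const _), setIntegral_const, hvol,
    integral_div, one_smul] at h1
  have h3 : ∫ t in uIoc x (x + σ), ‖f t‖ ^ 2 ≤
      ∫ t, (Icc (x - 1) (x + 1)).indicator ((region Λ).indicator fun t => ‖f t‖ ^ 2) t := by
    rw [integral_indicator measurableSet_Icc]
    refine le_trans (le_of_eq ?_) (setIntegral_mono_set hsq.integrableOn
      (Eventually.of_forall fun t => indicator_nonneg (fun _ _ => by positivity) _)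
      (LE.le.eventuallyLE hsub2))
    refine setIntegral_congr_fun measurableSet_uIoc fun t ht => ?_
    rw [indicator_of_mem (hsub ht)]
  rw [dist_zero_right, Real.norm_eq_abs] at hx ⊢
  rw [abs_of_nonneg h0]
  have h4 := lt_of_le_of_lt h3 (lt_of_le_of_lt (le_abs_self _) hx)
  have h5 : (∫ t in uIoc x (x + σ), ‖f t‖ ^ 2) / (2 * ε) < ε / 2 := by
    rw [div_lt_iff₀ (by positivity)]
    nlinarith
  linarith

/-- Taylor-type representation: `p (x)` paired with boundary data, for a weight `p` vanishing to
second order at the far end of a unit window. -/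
theorem IsAC2.tendsto_pairing {Λ : ℝ} {u : ℝ → ℂ} (hu : IsAC2 Λ u)
    (hL : MemLp u 2 (regionMeasure Λ)) {σ : ℝ} (hσ : |σ| = 1) {l : Filter ℝ}
    [l.IsCountablyGenerated] (hl : Tendsto (fun x : ℝ => |x|) l atTop)
    (hR : ∀ᶠ x in l, uIcc x (x + σ) ⊆ region Λ) {p p' p'' : ℝ → ℝ}
    (hp : ∀ s, HasDerivAt p (p' s) s) (hp' : ∀ s, HasDerivAt p' (p'' s) s)
    (hc : Continuous p'') (h1 : p σ = 0) (h1' : p' σ = 0) :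
    Tendsto (fun x => (p 0 : ℂ) * D Λ u x - p' 0 * u x) l (nhds 0) := by
  have cp : Continuous p := continuous_iff_continuousAt.2 fun s => (hp s).continuousAt
  have cp' : Continuous p' := continuous_iff_continuousAt.2 fun s => (hp' s).continuousAt
  obtain ⟨C, hC⟩ : ∃ C, ∀ s ∈ uIcc 0 σ, |p s| ≤ C ∧ |p'' s| ≤ C := by
    obtain ⟨C₁, h₁⟩ := isCompact_uIcc.exists_bound_of_continuousOn (s := uIcc 0 σ) cp.continuousOn
    obtain ⟨C₂, h₂⟩ := isCompact_uIcc.exists_bound_of_continuousOn (s := uIcc 0 σ) hc.continuousOn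
    exact ⟨max C₁ C₂, fun s hs => ⟨(h₁ s hs).trans (le_max_left _ _),
      (h₂ s hs).trans (le_max_right _ _)⟩⟩
  have T := (((tendsto_integral_norm_window hL hσ hl hR).add
    (tendsto_integral_norm_window hu.memLp_deriv2 hσ hl hR)).const_mul C)
  simp only [add_zero, mul_zero] at T
  refine squeeze_zero_norm' ?_ T
  filter_upwards [hR] with x hx
  have hxc := hx.trans (region_subset Λ)
  have acP : ∀ {q q' : ℝ → ℝ}, (∀ s, HasDerivAt q (q' s) s) → Continuous q' →
      AbsolutelyContinuousOnInterval (fun t => (q (t - x) : ℂ)) x (x + σ) := by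
    intro q q' hq hcq
    have hd : ∀ t, HasDerivAt (fun t => (q (t - x) : ℂ)) (q' (t - x) : ℂ) t := fun t =>
      ((hq (t - x)).comp_sub_const t x).ofReal_comp
    have : ContDiff ℝ 1 (fun t => (q (t - x) : ℂ)) := by
      rw [contDiff_one_iff_deriv]
      refine ⟨fun t => (hd t).differentiableAt, ?_⟩
      rw [funext fun t => (hd t).deriv]
      fun_prop
    exact this.contDiffOn.absolutelyContinuousOnInterval
  -- Lagrange's identity for `p (t - x)` and `u`: the terms at `x + σ` vanish because `p` and `p'`
  -- do at `σ`. The pairing at `x` is then at most `C ∫ (‖u‖ + ‖u''‖)` over the window.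
  have key := lagrange_identity (acP hp cp') (acP hp' hc) (hu.ac.uIcc hxc)
    (hu.ac_deriv.uIcc hxc) (a'' := fun t => (p'' (t - x) : ℂ)) (b'' := D Λ (D Λ u))
    (Eventually.of_forall fun t _ => ⟨((hp (t - x)).comp_sub_const t x).ofReal_comp,
      ((hp' (t - x)).comp_sub_const t x).ofReal_comp⟩)
    (by filter_upwards [hu.ae_hasDerivAt] with t ht hm using ht (hxc hm))
  simp only [add_sub_cancel_left, sub_self, h1, h1', Complex.ofReal_zero, zero_mul, zero_sub]
    at key
  rw [← norm_neg, ← key]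
  have hsub : uIoc x (x + σ) ⊆ region Λ := uIoc_subset_uIcc.trans hx
  have : IsFiniteMeasure (volume.restrict (uIoc x (x + σ))) := ⟨by simp⟩
  have hint : ∀ {f : ℝ → ℂ}, MemLp f 2 (regionMeasure Λ) →
      IntegrableOn (fun t => ‖f t‖) (uIoc x (x + σ)) := fun hf =>
    ((hf.mono_measure (Measure.restrict_mono hsub le_rfl)).integrable (by norm_num)).norm
  rw [← integral_add (hint hL) (hint hu.memLp_deriv2), ← integral_const_mul]
  refine (intervalIntegral.norm_integral_le_integral_norm_uIoc).trans ?_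
  refine integral_mono_of_nonneg (Eventually.of_forall fun _ => norm_nonneg _)
    (((hint hL).add (hint hu.memLp_deriv2)).const_mul C) ?_
  filter_upwards [ae_restrict_mem measurableSet_uIoc] with t ht
  have ht' : t - x ∈ uIcc 0 σ := by
    have := uIoc_subset_uIcc ht
    rw [mem_uIcc] at this ⊢
    rcases this with h | h
    · left; constructor <;> linarith [h.1, h.2]
    · right; constructor <;> linarith [h.1, h.2]
  obtain ⟨b1, b2⟩ := hC _ ht'
  refine (norm_sub_le _ _).trans ?_
  rw [norm_mul, norm_mul, Complex.norm_real, Complex.norm_real, Real.norm_eq_abs,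
    Real.norm_eq_abs, mul_add, add_comm]
  gcongr

/-- Two cubic Hermite weights with a double zero at `σ` separate `u` from `u'`. Since `σ² = 1`, they
are `s (1 - σs)²`, with data `(0, 1)` at `0`, and `(1 - σs)² (1 + 2σs)`, with data `(1, 0)`. The
sign of `σ` allows the window to point outward at either end. -/
theorem IsAC2.tendsto_zero {Λ : ℝ} {u : ℝ → ℂ} (hu : IsAC2 Λ u)
    (hL : MemLp u 2 (regionMeasure Λ)) {σ : ℝ} (hσ : |σ| = 1) {l : Filter ℝ}
    [l.IsCountablyGenerated] (hl : Tendsto (fun x : ℝ => |x|) l atTop)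
    (hR : ∀ᶠ x in l, uIcc x (x + σ) ⊆ region Λ) :
    Tendsto u l (nhds 0) ∧ Tendsto (D Λ u) l (nhds 0) := by
  have hσ2 : σ ^ 2 = 1 := by rw [← sq_abs, hσ]; norm_num
  have P := hu.tendsto_pairing hL hσ hl hR
    (p := fun s => s - 2 * σ * s ^ 2 + s ^ 3) (p' := fun s => 1 - 4 * σ * s + 3 * s ^ 2)
    (p'' := fun s => -4 * σ + 6 * s)
    (fun s => by
      refine (((hasDerivAt_id s).fun_sub ((hasDerivAt_pow 2 s).const_mul (2 * σ))).fun_add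
        (hasDerivAt_pow 3 s)).congr_deriv ?_
      norm_num; ring)
    (fun s => by
      refine (((hasDerivAt_const s (1 : ℝ)).fun_sub ((hasDerivAt_id s).const_mul (4 * σ))).fun_add
        ((hasDerivAt_pow 2 s).const_mul 3)).congr_deriv ?_
      norm_num; ring)
    (by fun_prop) (by linear_combination (-σ) * hσ2) (by linear_combination -hσ2)
  have Q := hu.tendsto_pairing hL hσ hl hR
    (p := fun s => 1 - 3 * s ^ 2 + 2 * σ * s ^ 3) (p' := fun s => -6 * s + 6 * σ * s ^ 2)
    (p'' := fun s => -6 + 12 * σ * s)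
    (fun s => by
      refine (((hasDerivAt_const s (1 : ℝ)).fun_sub ((hasDerivAt_pow 2 s).const_mul 3)).fun_add
        ((hasDerivAt_pow 3 s).const_mul (2 * σ))).congr_deriv ?_
      norm_num; ring)
    (fun s => by
      refine (((hasDerivAt_id s).const_mul (-6)).fun_add
        ((hasDerivAt_pow 2 s).const_mul (6 * σ))).congr_deriv ?_
      norm_num; ring)
    (by fun_prop) (by linear_combination (-3 + 2 * σ ^ 2 + 2) * hσ2)
    (by linear_combination 6 * σ * hσ2)
  norm_num at P Q
  exact ⟨by simpa using P.neg, Q⟩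

/-- The boundary form `conj u · v' - conj u' · v`. -/
noncomputable def boundaryForm (Λ : ℝ) (u v : ℝ → ℂ) (x : ℝ) : ℂ :=
  conj (u x) * D Λ v x - conj (D Λ u x) * v x

theorem IsAC2.tendsto_boundaryForm {Λ : ℝ} {u v : ℝ → ℂ} (hu : IsAC2 Λ u) (hv : IsAC2 Λ v)
    (hLu : MemLp u 2 (regionMeasure Λ)) (hLv : MemLp v 2 (regionMeasure Λ)) {σ : ℝ}
    (hσ : |σ| = 1) {l : Filter ℝ} [l.IsCountablyGenerated]
    (hl : Tendsto (fun x : ℝ => |x|) l atTop) (hR : ∀ᶠ x in l, uIcc x (x + σ) ⊆ region Λ) :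
    Tendsto (boundaryForm Λ u v) l (nhds 0) := by
  obtain ⟨u0, u1⟩ := hu.tendsto_zero hLu hσ hl hR
  obtain ⟨v0, v1⟩ := hv.tendsto_zero hLv hσ hl hR
  have h := ((u0.star).mul v1).sub ((u1.star).mul v0)
  simp only [star_zero, zero_mul, sub_zero] at h
  exact h

theorem integrable_conj_mul {Λ : ℝ} {f g : ℝ → ℂ} (hf : MemLp f 2 (regionMeasure Λ))
    (hg : MemLp g 2 (regionMeasure Λ)) :
    Integrable (fun x => conj (f x) * g x) (regionMeasure Λ) :=
  MemLp.integrable_mul (p := 2) (q := 2) hf.star hg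

/-- Green's formula on `Ω_Λ`. -/
theorem IsAC2.green {Λ : ℝ} (hΛ : 0 < Λ) {u v : ℝ → ℂ} (hu : IsAC2 Λ u) (hv : IsAC2 Λ v)
    (hLu : MemLp u 2 (regionMeasure Λ)) (hLv : MemLp v 2 (regionMeasure Λ)) :
    ∫ t in region Λ, (conj (u t) * D Λ (D Λ v) t - conj (D Λ (D Λ u) t) * v t) =
      boundaryForm Λ u v (-Λ) - boundaryForm Λ u v Λ := by
  have hint : IntegrableOn
      (fun t => conj (u t) * D Λ (D Λ v) t - conj (D Λ (D Λ u) t) * v t) (region Λ) :=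
    (integrable_conj_mul hLu hv.memLp_deriv2).sub (integrable_conj_mul hu.memLp_deriv2 hLv)
  have hintr : IntegrableOn _ (Ioi Λ) := hint.mono_set subset_union_right
  have hintl : IntegrableOn _ (Iio (-Λ)) := hint.mono_set subset_union_left
  have hdisj : Disjoint (Iio (-Λ)) (Ioi Λ) := by
    rw [Set.disjoint_left]
    intro x hx hx'
    simp only [mem_Iio, mem_Ioi] at hx hx'
    linarith
  rw [region, setIntegral_union hdisj measurableSet_Ioi hintl hintr]
  have right : ∫ t in Ioi Λ, (conj (u t) * D Λ (D Λ v) t - conj (D Λ (D Λ u) t) * v t) =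
      - boundaryForm Λ u v Λ := by
    refine tendsto_nhds_unique (intervalIntegral_tendsto_integral_Ioi Λ hintr tendsto_id) ?_
    have hb := (hu.tendsto_boundaryForm hv hLu hLv (σ := 1) (by simp) tendsto_abs_atTop_atTop
      (by
        filter_upwards [eventually_gt_atTop Λ] with x hx t ht
        rw [uIcc_of_le (by linarith)] at ht
        exact Or.inr (lt_of_lt_of_le hx ht.1))).sub_const (boundaryForm Λ u v Λ)
    rw [zero_sub] at hb
    refine hb.congr' ?_
    filter_upwards [eventually_ge_atTop Λ] with x hx
    refine (hu.lagrange hv fun t ht => ?_).symm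
    rw [uIcc_of_le hx] at ht
    exact Or.inr ht.1
  have left : ∫ t in Iio (-Λ), (conj (u t) * D Λ (D Λ v) t - conj (D Λ (D Λ u) t) * v t) =
      boundaryForm Λ u v (-Λ) := by
    rw [← integral_Iic_eq_integral_Iio]
    refine tendsto_nhds_unique (intervalIntegral_tendsto_integral_Iic (-Λ)
      ((integrableOn_Iic_iff_integrableOn_Iio (by simp)).2 hintl) tendsto_id) ?_
    have hb := (hu.tendsto_boundaryForm hv hLu hLv (σ := -1) (by simp) tendsto_abs_atBot_atTop
      (by
        filter_upwards [eventually_lt_atBot (-Λ)] with x hx t ht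
        rw [uIcc_of_ge (by linarith)] at ht
        exact Or.inl (lt_of_le_of_lt ht.2 hx))).const_sub (boundaryForm Λ u v (-Λ))
    rw [sub_zero] at hb
    refine hb.congr' ?_
    filter_upwards [eventually_le_atBot (-Λ)] with x hx
    refine (hu.lagrange hv fun t ht => ?_).symm
    rw [uIcc_of_le hx] at ht
    exact Or.inl ht.2
  rw [left, right, sub_eq_add_neg]

theorem inner_eq_integral {Λ : ℝ} {φ ψ : L2 Λ} {f g : ℝ → ℂ} (hφ : φ =ᵐ[regionMeasure Λ] f)
    (hψ : ψ =ᵐ[regionMeasure Λ] g) :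
    inner ℂ φ ψ = ∫ x in region Λ, conj (f x) * g x := by
  rw [L2.inner_def]
  refine integral_congr_ae ?_
  filter_upwards [hφ, hψ] with x h1 h2
  rw [h1, h2, RCLike.inner_apply, mul_comm]

/-- Green's formula for the operator `-d²/dx²` on its maximal domain. -/
theorem inner_negLaplacian_sub {Λ : ℝ} (hΛ : 0 < Λ) {φ ψ : maxDomain Λ} {u v : ℝ → ℂ}
    (hu : IsAC2 Λ u) (hv : IsAC2 Λ v) (hφ : (φ : L2 Λ) =ᵐ[regionMeasure Λ] u)
    (hψ : (ψ : L2 Λ) =ᵐ[regionMeasure Λ] v) :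
    inner ℂ (negLaplacian Λ φ) (ψ : L2 Λ) - inner ℂ (φ : L2 Λ) (negLaplacian Λ ψ) =
      boundaryForm Λ u v (-Λ) - boundaryForm Λ u v Λ := by
  have hLu : MemLp u 2 (regionMeasure Λ) := (Lp.memLp (φ : L2 Λ)).ae_eq hφ
  have hLv : MemLp v 2 (regionMeasure Λ) := (Lp.memLp (ψ : L2 Λ)).ae_eq hψ
  have e1 : negLaplacian Λ φ =ᵐ[regionMeasure Λ] fun x => -(D Λ (D Λ u) x) :=
    negDeriv2_ae_eq φ hu hφ
  have e2 : negLaplacian Λ ψ =ᵐ[regionMeasure Λ] fun x => -(D Λ (D Λ v) x) :=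
    negDeriv2_ae_eq ψ hv hψ
  rw [inner_eq_integral e1 hψ, inner_eq_integral hφ e2, ← hu.green hΛ hv hLu hLv,
    ← integral_sub (f := fun x => conj (-D Λ (D Λ u) x) * v x)
      (g := fun x => conj (u x) * -D Λ (D Λ v) x)
      (integrable_conj_mul hu.memLp_deriv2.neg hLv) (integrable_conj_mul hLu hv.memLp_deriv2.neg)]
  refine integral_congr_ae (Eventually.of_forall fun x => ?_)
  simp only [map_neg]
  ring

/-! ### Weak solutions -/

/-- A test function on an interval with vanishing integral is the derivative of a test function. -/
theorem exists_deriv_eq_of_integral_eq_zero {U : Set ℝ} (hU : U.OrdConnected) {k : ℝ → ℝ}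
    (hk : ContDiff ℝ (⊤ : ℕ∞) k) (hkc : HasCompactSupport k) (hkU : tsupport k ⊆ U)
    (h0 : ∫ x, k x = 0) :
    ∃ φ : ℝ → ℝ, ContDiff ℝ (⊤ : ℕ∞) φ ∧ HasCompactSupport φ ∧ tsupport φ ⊆ U ∧
      deriv φ = k := by
  rcases (tsupport k).eq_empty_or_nonempty with he | hne
  · rw [tsupport_eq_empty_iff] at he
    exact ⟨0, contDiff_const, HasCompactSupport.zero, by simp [tsupport], by simp [he]⟩
  have hcomp : IsCompact (tsupport k) := hkc
  obtain ⟨a, ha, hla⟩ := hcomp.exists_isLeast hne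
  obtain ⟨b, hb, hgb⟩ := hcomp.exists_isGreatest hne
  have hsupp : Function.support k ⊆ Ioo a b := by
    rw [← interior_Icc]
    refine interior_maximal (fun x hx => ?_) hk.continuous.isOpen_support
    exact ⟨hla (subset_tsupport k hx), hgb (subset_tsupport k hx)⟩
  have hderiv : ∀ x, HasDerivAt (fun x => ∫ t in a..x, k t) (k x) x := fun x =>
    intervalIntegral.integral_hasDerivAt_right (hk.continuous.intervalIntegrable _ _)
      (hk.continuous.stronglyMeasurableAtFilter _ _) hk.continuous.continuousAt
  have hd : deriv (fun x => ∫ t in a..x, k t) = k := funext fun x => (hderiv x).deriv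
  -- To the left of `a` the integrand vanishes; to the right of `b` all of it has been integrated,
  -- and the total is zero.
  have hs : Function.support (fun x => ∫ t in a..x, k t) ⊆ Icc a b := by
    intro x hx
    by_contra hxab
    refine hx ?_
    change ∫ t in a..x, k t = 0
    rw [mem_Icc, not_and_or, not_le, not_le] at hxab
    rcases hxab with h | h
    · rw [intervalIntegral.integral_congr (g := fun _ => (0 : ℝ)), intervalIntegral.integral_zero]
      intro t ht
      rw [uIcc_of_ge h.le] at ht
      by_contra hkt
      exact absurd (hsupp hkt).1 (not_lt.2 ht.2)
    · rw [intervalIntegral.integral_eq_integral_of_support_subset, h0]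
      exact fun t ht => ⟨(hsupp ht).1, (hsupp ht).2.le.trans h.le⟩
  -- The primitive may be nonzero in gaps of the support of `k`, so `U` must contain all of `[a,
  -- b]`: this is where order-connectedness enters.
  refine ⟨_, ?_, HasCompactSupport.of_support_subset_isCompact isCompact_Icc hs,
    (closure_minimal hs isClosed_Icc).trans (hU.out (hkU ha) (hkU hb)), hd⟩
  rw [contDiff_infty_iff_deriv, hd]
  exact ⟨fun x => (hderiv x).differentiableAt, hk⟩

theorem integrable_smul_of_tsupport_subset {U : Set ℝ} {g : ℝ → ℝ} {h : ℝ → ℂ}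
    (hg : Continuous g) (hgc : HasCompactSupport g) (hgU : tsupport g ⊆ U)
    (hh : LocallyIntegrableOn h U) : Integrable (fun x => g x • h x) := by
  have h1 : IntegrableOn h (tsupport g) := hh.integrableOn_compact_subset hgU hgc
  have h2 : IntegrableOn (fun x => g x • h x) (tsupport g) :=
    h1.continuousOn_smul hg.continuousOn hgc
  rw [← integrableOn_iff_integrable_of_support_subset (s := tsupport g)]
  · exact h2
  · exact (Function.support_smul_subset_left g h).trans (subset_tsupport g)

theorem exists_test_integral_eq_one {U : Set ℝ} (hU : IsOpen U) (hne : U.Nonempty) :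
    ∃ ρ : ℝ → ℝ, ContDiff ℝ (⊤ : ℕ∞) ρ ∧ HasCompactSupport ρ ∧ tsupport ρ ⊆ U ∧
      ∫ x, ρ x = 1 := by
  obtain ⟨p, hp⟩ := hne
  obtain ⟨ε, hε, hball⟩ := Metric.isOpen_iff.1 hU p hp
  let f : ContDiffBump p := ⟨ε / 4, ε / 2, by positivity, by linarith⟩
  refine ⟨f.normed volume, f.contDiff_normed, f.hasCompactSupport_normed, ?_, f.integral_normed⟩
  rw [f.tsupport_normed_eq]
  exact (Metric.closedBall_subset_ball (by change ε / 2 < ε; linarith)).trans hball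

/-- Subtracting a multiple of the unit mass `ρ` removes the integral of `g`, which is the only
obstruction to having a test function as primitive. -/
theorem exists_deriv_eq_sub_integral_mul {U : Set ℝ} (hU : U.OrdConnected) {g ρ : ℝ → ℝ}
    (hg : ContDiff ℝ (⊤ : ℕ∞) g) (hgc : HasCompactSupport g) (hgU : tsupport g ⊆ U)
    (hρ : ContDiff ℝ (⊤ : ℕ∞) ρ) (hρc : HasCompactSupport ρ) (hρU : tsupport ρ ⊆ U)
    (hρ1 : ∫ x, ρ x = 1) :
    ∃ φ : ℝ → ℝ, ContDiff ℝ (⊤ : ℕ∞) φ ∧ HasCompactSupport φ ∧ tsupport φ ⊆ U ∧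
      deriv φ = fun x => g x - (∫ x, g x) * ρ x := by
  have ig : Integrable g := hg.continuous.integrable_of_hasCompactSupport hgc
  have iρ : Integrable ρ := hρ.continuous.integrable_of_hasCompactSupport hρc
  have hs : Function.support (fun x => (∫ x, g x) * ρ x) ⊆ Function.support ρ :=
    Function.support_const_smul_subset (∫ x, g x) ρ
  refine exists_deriv_eq_of_integral_eq_zero hU (hg.sub (contDiff_const.mul hρ))
    (hgc.sub (hρc.mono hs)) ((tsupport_sub _ _).trans (union_subset hgU
      ((closure_mono hs).trans hρU))) ?_
  rw [integral_sub ig (iρ.const_mul _), integral_const_mul, hρ1, mul_one, sub_self]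

/-- The lemma of du Bois-Reymond. -/
theorem ae_eq_const_of_integral_deriv_smul_eq_zero {U : Set ℝ} (hU : IsOpen U)
    (hUc : U.OrdConnected) {h : ℝ → ℂ} (hh : LocallyIntegrableOn h U)
    (H : ∀ g : ℝ → ℝ, ContDiff ℝ (⊤ : ℕ∞) g → HasCompactSupport g → tsupport g ⊆ U →
      ∫ x, deriv g x • h x = 0) : ∃ c : ℂ, ∀ᵐ x : ℝ, x ∈ U → h x = c := by
  rcases U.eq_empty_or_nonempty with rfl | hne
  · exact ⟨0, by simp⟩
  obtain ⟨ρ, hρ, hρc, hρU, hρ1⟩ := exists_test_integral_eq_one hU hne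
  -- Testing with `φ' = g - (∫ g) ρ` gives `∫ g h = (∫ g) ∫ ρ h`, which identifies the constant.
  refine ⟨∫ x, ρ x • h x, ?_⟩
  have key := hU.ae_eq_zero_of_integral_contDiff_smul_eq_zero (μ := volume)
    (f := fun x => h x - ∫ x, ρ x • h x)
    (hh.sub ((locallyIntegrable_const _).locallyIntegrableOn _)) ?_
  · filter_upwards [key] with x hx hxU using sub_eq_zero.1 (hx hxU)
  intro g hg hgc hgU
  have ig : Integrable g := hg.continuous.integrable_of_hasCompactSupport hgc
  obtain ⟨φ, hφ, hφc, hφU, hd⟩ :=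
    exists_deriv_eq_sub_integral_mul hUc hg hgc hgU hρ hρc hρU hρ1
  have h1 := H φ hφ hφc hφU
  have i1 := integrable_smul_of_tsupport_subset hg.continuous hgc hgU hh
  have i2 := integrable_smul_of_tsupport_subset hρ.continuous hρc hρU hh
  rw [hd] at h1
  simp only [sub_smul, mul_smul] at h1
  rw [integral_sub i1 (i2.fun_smul _), integral_smul] at h1
  simp only [smul_sub]
  rw [integral_sub i1 (ig.smul_const _), integral_smul_const, h1]

/-- The second-order lemma of du Bois-Reymond. -/
theorem ae_eq_affine_of_integral_deriv2_smul_eq_zero {U : Set ℝ} (hU : IsOpen U)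
    (hUc : U.OrdConnected) {h : ℝ → ℂ} (hh : LocallyIntegrableOn h U)
    (H : ∀ g : ℝ → ℝ, ContDiff ℝ (⊤ : ℕ∞) g → HasCompactSupport g → tsupport g ⊆ U →
      ∫ x, deriv (deriv g) x • h x = 0) :
    ∃ c d : ℂ, ∀ᵐ x : ℝ, x ∈ U → h x = c + d * x := by
  rcases U.eq_empty_or_nonempty with rfl | hne
  · exact ⟨0, 0, by simp⟩
  obtain ⟨ρ, hρ, hρc, hρU, hρ1⟩ := exists_test_integral_eq_one hU hne
  set d : ℂ := ∫ x, deriv ρ x • h x with hd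
  have hlin : LocallyIntegrableOn (fun x : ℝ => d * (x : ℂ)) U :=
    (Continuous.locallyIntegrable (by fun_prop)).locallyIntegrableOn _
  have hD : ∀ {f : ℝ → ℝ}, ContDiff ℝ (⊤ : ℕ∞) f → ContDiff ℝ (⊤ : ℕ∞) (deriv f) := fun hf => by
    have := hf.iterate_deriv 1
    simpa using this
  -- With `φ'' = g' - (∫ g) ρ'` the hypothesis reads `∫ g' h = (∫ g) d`, while integration by parts
  -- gives `∫ g' (d x) = -(∫ g) d`. So `h + d x` meets the first-order lemma, and `h` has slope
  -- `-d`.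
  obtain ⟨c, hc⟩ := ae_eq_const_of_integral_deriv_smul_eq_zero hU hUc (hh.add hlin) (by
    intro g hg hgc hgU
    have ig : Integrable g := hg.continuous.integrable_of_hasCompactSupport hgc
    obtain ⟨φ, hφ, hφc, hφU, hdφ⟩ :=
      exists_deriv_eq_sub_integral_mul hUc hg hgc hgU hρ hρc hρU hρ1
    have h1 := H φ hφ hφc hφU
    have e1 : deriv (deriv φ) = fun x => deriv g x - (∫ x, g x) * deriv ρ x := by
      funext x
      rw [hdφ]
      exact ((hg.differentiable (by simp) x).hasDerivAt.sub
        ((hρ.differentiable (by simp) x).hasDerivAt.const_mul _)).deriv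
    have sub1 : ∀ {f : ℝ → ℝ}, tsupport f ⊆ U → tsupport (deriv f) ⊆ U := fun hf =>
      (closure_minimal (support_deriv_subset) (isClosed_tsupport _)).trans hf
    have i1 := integrable_smul_of_tsupport_subset (hD hg).continuous hgc.deriv (sub1 hgU) hh
    have i2 := integrable_smul_of_tsupport_subset (hD hρ).continuous hρc.deriv (sub1 hρU) hh
    have i3 := integrable_smul_of_tsupport_subset (hD hg).continuous hgc.deriv (sub1 hgU) hlin
    simp only [e1, sub_smul, mul_smul] at h1
    rw [integral_sub i1 (i2.fun_smul _), integral_smul, ← hd] at h1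
    have i4 : Integrable (fun x : ℝ => (g x : ℂ) * d) := ig.ofReal.mul_const d
    have h2 : ∫ x, (deriv g x • (d * (x : ℂ)) + (g x : ℂ) * d) = 0 := by
      refine integral_eq_zero_of_hasDerivAt_of_integrable
        (f := fun x : ℝ => (g x : ℂ) * (d * x)) (fun x => ?_) (i3.add i4) ?_
      · refine (((hg.differentiable (by simp) x).hasDerivAt.ofReal_comp).fun_mul
          ((Complex.ofRealCLM.hasDerivAt (x := x)).const_mul d)).congr_deriv ?_
        simp
      · simpa using integrable_smul_of_tsupport_subset hg.continuous hgc hgU hlin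
    rw [integral_add i3 i4, integral_mul_const, integral_complex_ofReal] at h2
    simp only [Pi.add_apply, smul_add]
    rw [integral_add i1 i3]
    rw [Complex.real_smul] at h1
    linear_combination h1 + h2)
  refine ⟨c, -d, ?_⟩
  filter_upwards [hc] with x hx hxU
  have := hx hxU
  simp only [Pi.add_apply] at this
  linear_combination this

/-! ### Gluing `AC²` functions -/

/-- `p'` is the derivative of `p` and a locally absolutely continuous primitive of `p''`. -/
structure IsDoublePrimitive (p p' p'' : ℝ → ℂ) : Prop where
  hasDerivAt : ∀ x, HasDerivAt p (p' x) x
  ac_deriv : ∀ a b, AbsolutelyContinuousOnInterval p' a b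
  ae_hasDerivAt : ∀ᵐ x, HasDerivAt p' (p'' x) x

theorem IsDoublePrimitive.ac {p p' p'' : ℝ → ℂ} (h : IsDoublePrimitive p p' p'') (a b : ℝ) :
    AbsolutelyContinuousOnInterval p a b := by
  have hc : Continuous p' := continuous_iff_continuousAt.2 fun x => by
    have h1 := (h.ac_deriv (x - 1) (x + 1)).continuousOn
    rw [uIcc_of_le (by linarith)] at h1
    exact h1.continuousAt (Icc_mem_nhds (by linarith) (by linarith))
  have h1 : ContDiff ℝ 1 p := by
    rw [contDiff_one_iff_deriv, funext fun x => (h.hasDerivAt x).deriv]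
    exact ⟨fun x => (h.hasDerivAt x).differentiableAt, hc⟩
  exact h1.contDiffOn.absolutelyContinuousOnInterval

theorem IsDoublePrimitive.of_contDiff {p : ℝ → ℂ} (hp : ContDiff ℝ (⊤ : ℕ∞) p) :
    IsDoublePrimitive p (deriv p) (deriv (deriv p)) := by
  have h1 : ContDiff ℝ (⊤ : ℕ∞) (deriv p) := by
    have := hp.iterate_deriv 1
    simpa using this
  exact ⟨fun x => (hp.differentiable (by simp) x).hasDerivAt,
    fun a b => (h1.of_le (by exact_mod_cast le_top)).contDiffOn.absolutelyContinuousOnInterval,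
    Eventually.of_forall fun x => (h1.differentiable (by simp) x).hasDerivAt⟩

theorem IsDoublePrimitive.affine_add {p p' p'' : ℝ → ℂ} (h : IsDoublePrimitive p p' p'')
    (c d : ℂ) : IsDoublePrimitive (fun x => c + d * x + p x) (fun x => d + p' x) p'' where
  hasDerivAt x := by
    refine (((Complex.ofRealCLM.hasDerivAt (x := x)).const_mul d).const_add c
      |>.fun_add (h.hasDerivAt x)).congr_deriv ?_
    simp
  ac_deriv a b := (contDiffOn_const.absolutelyContinuousOnInterval).fun_add (h.ac_deriv a b)
  ae_hasDerivAt := by filter_upwards [h.ae_hasDerivAt] with x hx using hx.const_add d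

theorem IsDoublePrimitive.of_locallyIntegrable {f : ℝ → ℂ} (hf : LocallyIntegrable f) :
    IsDoublePrimitive (fun x => ∫ s in (0 : ℝ)..x, ∫ t in (0 : ℝ)..s, f t)
      (fun x => ∫ t in (0 : ℝ)..x, f t) f := by
  have hi : ∀ a b, IntervalIntegrable f volume a b := fun a b =>
    (hf.integrableOn_isCompact isCompact_uIcc).intervalIntegrable
  have hc : Continuous fun x => ∫ t in (0 : ℝ)..x, f t := intervalIntegral.continuous_primitive hi 0
  refine ⟨fun x => intervalIntegral.integral_hasDerivAt_right (hc.intervalIntegrable _ _)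
      (hc.stronglyMeasurableAtFilter _ _) hc.continuousAt, fun a b => ?_, ?_⟩
  -- The interval is enlarged to contain the base point `0` of the primitive.
  · have hle : min (min a b) 0 ≤ max (max a b) 0 := (min_le_right _ _).trans (le_max_right _ _)
    refine (absolutelyContinuousOnInterval_integral (hi (min (min a b) 0) (max (max a b) 0))
      ?_).mono ?_
    · exact mem_uIcc.2 (Or.inl ⟨min_le_right _ _, le_max_right _ _⟩)
    · rw [uIcc_of_le hle]
      exact Icc_subset_Icc (min_le_left _ _) (le_max_left _ _)
  · filter_upwards [LocallyIntegrable.ae_hasDerivAt_integral hf] with x hx using hx 0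

theorem Icc_subset_closedRegion {Λ : ℝ} (hΛ : 0 < Λ) {a b : ℝ} (hab : a ≤ b)
    (h : Icc a b ⊆ closedRegion Λ) : b ≤ -Λ ∨ Λ ≤ a := by
  by_contra hcon
  rw [not_or, not_le, not_le] at hcon
  have ha : a ≤ -Λ := (h (left_mem_Icc.2 hab)).resolve_right (not_le.2 hcon.2)
  have hb : Λ ≤ b := (h (right_mem_Icc.2 hab)).resolve_left (not_le.2 hcon.1)
  rcases h (show (0 : ℝ) ∈ Icc a b from ⟨by linarith, by linarith⟩) with h0 | h0
  · simp only [mem_Iic] at h0; linarith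
  · simp only [mem_Ici] at h0; linarith

/-- The branches switch at `0`, inside the removed gap, so a compact interval in the closed region
sees only one of them. -/
theorem locAC_ite {Λ : ℝ} (hΛ : 0 < Λ) {p r : ℝ → ℂ}
    (hp : ∀ a b, AbsolutelyContinuousOnInterval p a b)
    (hr : ∀ a b, AbsolutelyContinuousOnInterval r a b) :
    LocAC Λ (fun x => if x < 0 then p x else r x) := by
  intro a b hab h
  rcases Icc_subset_closedRegion hΛ hab h with hb | ha
  · refine (hp a b).congr fun x hx => ?_
    rw [uIcc_of_le hab] at hx
    exact (if_pos (by linarith [hx.2])).symm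
  · refine (hr a b).congr fun x hx => ?_
    rw [uIcc_of_le hab] at hx
    exact (if_neg (by linarith [hx.1])).symm

theorem uniqueDiffWithinAt_closedRegion {Λ x : ℝ} (hx : x ∈ closedRegion Λ) :
    UniqueDiffWithinAt ℝ (closedRegion Λ) x := by
  rcases hx with hx | hx
  · exact (uniqueDiffOn_Iic _ x hx).mono subset_union_left
  · exact (uniqueDiffOn_Ici _ x hx).mono subset_union_right

theorem hasDerivAt_ite {p p' r r' : ℝ → ℂ} {x : ℝ} (hx : x ≠ 0) (hp : HasDerivAt p (p' x) x)
    (hr : HasDerivAt r (r' x) x) :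
    HasDerivAt (fun x => if x < 0 then p x else r x) (if x < 0 then p' x else r' x) x := by
  rcases lt_or_gt_of_ne hx with h | h
  · rw [if_pos h]
    refine hp.congr_of_eventuallyEq ?_
    filter_upwards [Iio_mem_nhds h] with y hy using if_pos hy
  · rw [if_neg h.not_gt]
    refine hr.congr_of_eventuallyEq ?_
    filter_upwards [Ioi_mem_nhds h] with y hy using if_neg (not_lt.2 (le_of_lt hy))

theorem ne_zero_of_mem_closedRegion {Λ : ℝ} (hΛ : 0 < Λ) {x : ℝ} (hx : x ∈ closedRegion Λ) :
    x ≠ 0 := by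
  rintro rfl
  rcases hx with h | h
  · simp only [mem_Iic] at h; linarith
  · simp only [mem_Ici] at h; linarith

section Glue

variable {Λ : ℝ} {p p' p'' r r' r'' : ℝ → ℂ}

theorem IsDoublePrimitive.D_ite (hΛ : 0 < Λ) (hp : IsDoublePrimitive p p' p'')
    (hr : IsDoublePrimitive r r' r'') :
    EqOn (D Λ fun x => if x < 0 then p x else r x) (fun x => if x < 0 then p' x else r' x)
      (closedRegion Λ) := fun x hx =>
  (hasDerivAt_ite (ne_zero_of_mem_closedRegion hΛ hx) (hp.hasDerivAt x)
    (hr.hasDerivAt x)).hasDerivWithinAt.derivWithin (uniqueDiffWithinAt_closedRegion hx)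

theorem IsDoublePrimitive.D2_ite (hΛ : 0 < Λ) (hp : IsDoublePrimitive p p' p'')
    (hr : IsDoublePrimitive r r' r'') :
    D Λ (D Λ fun x => if x < 0 then p x else r x) =ᵐ[regionMeasure Λ]
      fun x => if x < 0 then p'' x else r'' x := by
  filter_upwards [ae_mem_region Λ, ae_restrict_of_ae hp.ae_hasDerivAt,
    ae_restrict_of_ae hr.ae_hasDerivAt] with x hx h1 h2
  rw [eqOn_D ((hp.D_ite hΛ hr).mono (region_subset Λ)) hx, D_eq_deriv _ hx]
  exact (hasDerivAt_ite (ne_zero_of_mem_closedRegion hΛ (region_subset Λ hx)) h1 h2).deriv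

theorem IsDoublePrimitive.isAC2_ite (hΛ : 0 < Λ) (hp : IsDoublePrimitive p p' p'')
    (hr : IsDoublePrimitive r r' r'')
    (hL : MemLp (fun x => if x < 0 then p'' x else r'' x) 2 (regionMeasure Λ)) :
    IsAC2 Λ fun x => if x < 0 then p x else r x where
  ac := locAC_ite hΛ hp.ac hr.ac
  diff x hx := (hasDerivAt_ite (ne_zero_of_mem_closedRegion hΛ hx) (hp.hasDerivAt x)
    (hr.hasDerivAt x)).differentiableAt.differentiableWithinAt
  ac_deriv := (locAC_ite hΛ hp.ac_deriv hr.ac_deriv).congr (hp.D_ite hΛ hr).symm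
  memLp_deriv2 := hL.ae_eq (hp.D2_ite hΛ hr).symm

end Glue

/-! ### Weak solutions have `AC²` representatives -/

theorem memLp_indicator_region {Λ : ℝ} {f : ℝ → ℂ} (hf : MemLp f 2 (regionMeasure Λ)) :
    MemLp ((region Λ).indicator f) 2 volume :=
  (memLp_indicator_iff_restrict (isOpen_region Λ).measurableSet).2 hf

/-- The double primitive of `W` solves the same weak equation, so its difference from `V` has
vanishing weak second derivative and is affine. -/
theorem ae_eq_of_weak_deriv2 {U : Set ℝ} (hU : IsOpen U) (hUc : U.OrdConnected) {V W : ℝ → ℂ}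
    (hV : LocallyIntegrable V) (hW : LocallyIntegrable W)
    (H : ∀ g : ℝ → ℝ, ContDiff ℝ (⊤ : ℕ∞) g → HasCompactSupport g → tsupport g ⊆ U →
      ∫ x, deriv (deriv g) x • V x = ∫ x, g x • W x) :
    ∃ c d : ℂ, ∀ᵐ x : ℝ, x ∈ U →
      V x = c + d * x + ∫ s in (0 : ℝ)..x, ∫ t in (0 : ℝ)..s, W t := by
  have hP := IsDoublePrimitive.of_locallyIntegrable hW
  set P : ℝ → ℂ := fun x => ∫ s in (0 : ℝ)..x, ∫ t in (0 : ℝ)..s, W t with hPdef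
  have hPc : Continuous P := continuous_iff_continuousAt.2 fun x => (hP.hasDerivAt x).continuousAt
  have hPl : LocallyIntegrableOn P U := hPc.locallyIntegrable.locallyIntegrableOn _
  have hVl : LocallyIntegrableOn V U := hV.locallyIntegrableOn _
  obtain ⟨c, d, h⟩ := ae_eq_affine_of_integral_deriv2_smul_eq_zero hU hUc (hVl.sub hPl) (by
    intro g hg hgc hgU
    have hg1 : ContDiff ℝ (⊤ : ℕ∞) (deriv g) := by
      have := hg.iterate_deriv 1
      simpa using this
    have hg2 : ContDiff ℝ (⊤ : ℕ∞) (deriv (deriv g)) := by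
      have := hg1.iterate_deriv 1
      simpa using this
    have hs2 : tsupport (deriv (deriv g)) ⊆ U :=
      (tsupport_deriv_subset.trans tsupport_deriv_subset).trans hgU
    have i1 := integrable_smul_of_tsupport_subset hg2.continuous hgc.deriv.deriv hs2 hVl
    have i2 := integrable_smul_of_tsupport_subset hg2.continuous hgc.deriv.deriv hs2 hPl
    have i3 := integrable_smul_of_tsupport_subset hg.continuous hgc hgU
      (hW.locallyIntegrableOn U)
    simp only [Pi.sub_apply, smul_sub]
    rw [integral_sub i1 i2, H g hg hgc hgU, ← integral_sub i3 i2]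
    -- The support of `g` lies strictly inside `(-R, R)`, so Lagrange's identity on that interval
    -- has no boundary terms.
    obtain ⟨R, hR⟩ := hgc.isCompact.isBounded.subset_ball_lt 0 0
    obtain ⟨hR0, hRs⟩ := hR
    have hout : ∀ x : ℝ, R ≤ |x| → x ∉ tsupport g := fun x hx hxs => by
      have := hRs hxs
      rw [mem_ball_zero_iff, Real.norm_eq_abs] at this
      linarith
    have hz : ∀ x, x ∉ tsupport g → g x = 0 ∧ deriv g x = 0 ∧ deriv (deriv g) x = 0 :=
      fun x hx => ⟨image_eq_zero_of_notMem_tsupport hx,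
        image_eq_zero_of_notMem_tsupport fun h => hx (tsupport_deriv_subset h),
        image_eq_zero_of_notMem_tsupport fun h =>
          hx (tsupport_deriv_subset (tsupport_deriv_subset h))⟩
    have hsub : (Function.support fun x => g x • W x - deriv (deriv g) x • P x) ⊆
        Ioc (-R) R := by
      intro x hx
      by_contra hxI
      refine hx ?_
      obtain ⟨h1, -, h3⟩ := hz x (hout x (by
        by_contra hlt
        rw [not_le, abs_lt] at hlt
        exact hxI ⟨hlt.1, hlt.2.le⟩))
      simp only [h1, h3, zero_smul, sub_zero]
    rw [← intervalIntegral.integral_eq_integral_of_support_subset hsub]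
    have acg : ∀ {f : ℝ → ℝ}, ContDiff ℝ (⊤ : ℕ∞) f → ∀ a b,
        AbsolutelyContinuousOnInterval (fun x => (f x : ℂ)) a b := fun hf a b =>
      ((hf.of_le (by exact_mod_cast le_top)).contDiffOn.absolutelyContinuousOnInterval).clm_comp
        Complex.ofRealCLM
    have key := lagrange_identity (x := -R) (y := R) (acg hg _ _) (acg hg1 _ _)
      (a'' := fun x => ((deriv (deriv g) x : ℝ) : ℂ)) (hP.ac _ _) (hP.ac_deriv _ _)
      (b'' := W) (Eventually.of_forall fun x _ =>
        ⟨(hg.differentiable (by simp) x).hasDerivAt.ofReal_comp,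
          (hg1.differentiable (by simp) x).hasDerivAt.ofReal_comp⟩)
      (by filter_upwards [hP.ae_hasDerivAt] with x hx _ using ⟨hP.hasDerivAt x, hx⟩)
    obtain ⟨a1, a2, -⟩ := hz R (hout R (le_abs_self R))
    obtain ⟨b1, b2, -⟩ := hz (-R) (hout (-R) (by rw [abs_neg]; exact le_abs_self R))
    rw [a1, a2, b1, b2] at key
    simp only [Complex.real_smul]
    simpa using key)
  refine ⟨c, d, ?_⟩
  filter_upwards [h] with x hx hxU
  have := hx hxU
  simp only [Pi.sub_apply] at this
  linear_combination this

/-- Extension by zero gives data on the whole line. Each half-line then has its own affine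
correction to one common double primitive, and the two solutions are glued in the gap. -/
theorem exists_isAC2_of_weak_deriv2 {Λ : ℝ} (hΛ : 0 < Λ) {V W : ℝ → ℂ}
    (hV : MemLp V 2 (regionMeasure Λ)) (hW : MemLp W 2 (regionMeasure Λ))
    (H : ∀ g : ℝ → ℝ, ContDiff ℝ (⊤ : ℕ∞) g → HasCompactSupport g → tsupport g ⊆ region Λ →
      ∫ x in region Λ, deriv (deriv g) x • V x = ∫ x in region Λ, g x • W x) :
    ∃ u, IsAC2 Λ u ∧ V =ᵐ[regionMeasure Λ] u ∧ D Λ (D Λ u) =ᵐ[regionMeasure Λ] W := by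
  have hV' : LocallyIntegrable ((region Λ).indicator V) :=
    (memLp_indicator_region hV).locallyIntegrable (by norm_num)
  have hW' : LocallyIntegrable ((region Λ).indicator W) :=
    (memLp_indicator_region hW).locallyIntegrable (by norm_num)
  have H' : ∀ g : ℝ → ℝ, ContDiff ℝ (⊤ : ℕ∞) g → HasCompactSupport g → tsupport g ⊆ region Λ →
      ∫ x, deriv (deriv g) x • (region Λ).indicator V x =
        ∫ x, g x • (region Λ).indicator W x := by
    intro g hg hgc hgU
    have := H g hg hgc hgU
    rw [← integral_indicator (isOpen_region Λ).measurableSet,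
      ← integral_indicator (isOpen_region Λ).measurableSet] at this
    simpa only [indicator_smul] using this
  obtain ⟨c₁, d₁, h₁⟩ := ae_eq_of_weak_deriv2 (U := Iio (-Λ)) isOpen_Iio ordConnected_Iio hV' hW'
    fun g hg hgc hgU => H' g hg hgc (hgU.trans subset_union_left)
  obtain ⟨c₂, d₂, h₂⟩ := ae_eq_of_weak_deriv2 (U := Ioi Λ) isOpen_Ioi ordConnected_Ioi hV' hW'
    fun g hg hgc hgU => H' g hg hgc (hgU.trans subset_union_right)
  have hP := IsDoublePrimitive.of_locallyIntegrable hW'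
  have hind : (fun x : ℝ => if x < 0 then (region Λ).indicator W x else (region Λ).indicator W x)
      =ᵐ[regionMeasure Λ] W := by
    filter_upwards [ae_mem_region Λ] with x hx
    rw [ite_self, indicator_of_mem hx]
  refine ⟨_, (hP.affine_add c₁ d₁).isAC2_ite hΛ (hP.affine_add c₂ d₂) (hW.ae_eq hind.symm), ?_,
    ((hP.affine_add c₁ d₁).D2_ite hΛ (hP.affine_add c₂ d₂)).trans hind⟩
  filter_upwards [ae_mem_region Λ, ae_restrict_of_ae h₁, ae_restrict_of_ae h₂] with x hx h1 h2
  rw [← indicator_of_mem hx V]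
  rcases hx with hx | hx
  · rw [if_pos (by simp only [mem_Iio] at hx; linarith)]
    exact h1 hx
  · rw [if_neg (by simp only [mem_Ioi] at hx; linarith)]
    exact h2 hx

/-! ### The minimal and the maximal operator -/

/-- The boundary values of `u` and of `u'` at `±Λ` vanish. -/
def ZeroData (Λ : ℝ) (u : ℝ → ℂ) : Prop :=
  (u (-Λ) = 0 ∧ D Λ u (-Λ) = 0) ∧ u Λ = 0 ∧ D Λ u Λ = 0

theorem ZeroData.boundaryForm {Λ : ℝ} {u : ℝ → ℂ} (hu : ZeroData Λ u) (v : ℝ → ℂ) :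
    boundaryForm Λ v u (-Λ) - boundaryForm Λ v u Λ = 0 := by
  simp [Junction.boundaryForm, hu.1.1, hu.1.2, hu.2.1, hu.2.2]

theorem isAC2_of_contDiff {Λ : ℝ} (hΛ : 0 < Λ) {u : ℝ → ℂ} (hu : ContDiff ℝ (⊤ : ℕ∞) u)
    (huc : HasCompactSupport u) (hus : tsupport u ⊆ region Λ) :
    IsAC2 Λ u ∧ ZeroData Λ u ∧ EqOn (D Λ (D Λ u)) (deriv (deriv u)) (region Λ) := by
  have hP := IsDoublePrimitive.of_contDiff hu
  have h2 : ContDiff ℝ (⊤ : ℕ∞) (deriv (deriv u)) := by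
    have := hu.iterate_deriv 2
    simpa using this
  have hL : MemLp (deriv (deriv u)) 2 (regionMeasure Λ) :=
    h2.continuous.memLp_of_hasCompactSupport huc.deriv.deriv
  -- Gluing `u` to itself brings a globally smooth function under the gluing lemmas.
  have hA := hP.isAC2_ite hΛ hP (by simpa only [ite_self] using hL)
  have hD := hP.D_ite hΛ hP
  simp only [ite_self] at hA hD
  have hz : ∀ x ∉ region Λ, u x = 0 ∧ deriv u x = 0 := fun x hx =>
    ⟨image_eq_zero_of_notMem_tsupport fun h => hx (hus h),
      image_eq_zero_of_notMem_tsupport fun h => hx (hus (tsupport_deriv_subset h))⟩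
  have h1 : -Λ ∉ region Λ := by
    rintro (h | h) <;> simp only [mem_Iio, mem_Ioi] at h <;> linarith
  have h1' : Λ ∉ region Λ := by
    rintro (h | h) <;> simp only [mem_Iio, mem_Ioi] at h <;> linarith
  refine ⟨hA, ⟨⟨(hz _ h1).1, ?_⟩, (hz _ h1').1, ?_⟩, fun x hx => ?_⟩
  · exact (hD (neg_mem_closedRegion Λ)).trans (hz _ h1).2
  · exact (hD (mem_closedRegion Λ)).trans (hz _ h1').2
  · rw [eqOn_D (hD.mono (region_subset Λ)) hx, D_eq_deriv _ hx]

theorem exists_zeroData_of_mem_testSpace {Λ : ℝ} (hΛ : 0 < Λ) {φ : L2 Λ}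
    (hφ : φ ∈ testSpace Λ) :
    ∃ u, IsAC2 Λ u ∧ φ =ᵐ[regionMeasure Λ] u ∧ ZeroData Λ u := by
  obtain ⟨u, hu, huc, hus, h⟩ := hφ
  obtain ⟨h1, h2, -⟩ := isAC2_of_contDiff hΛ hu huc hus
  exact ⟨u, h1, h, h2⟩

/-- The class in `L²(Ω_Λ)` of a real test function, with its image under `-d²/dx²`. -/
theorem exists_test_class {Λ : ℝ} (hΛ : 0 < Λ) {g : ℝ → ℝ} (hg : ContDiff ℝ (⊤ : ℕ∞) g)
    (hgc : HasCompactSupport g) (hgU : tsupport g ⊆ region Λ) :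
    ∃ φ : maxDomain Λ, (φ : L2 Λ) ∈ testSpace Λ ∧
      (φ : L2 Λ) =ᵐ[regionMeasure Λ] (fun x => (g x : ℂ)) ∧
      negLaplacian Λ φ =ᵐ[regionMeasure Λ] fun x => -((deriv (deriv g) x : ℝ) : ℂ) := by
  set u : ℝ → ℂ := fun x => (g x : ℂ) with hu
  have hu1 : ContDiff ℝ (⊤ : ℕ∞) u := Complex.ofRealCLM.contDiff.comp hg
  have huc : HasCompactSupport u := hgc.comp_left (g := fun r : ℝ => (r : ℂ)) rfl
  have hus : tsupport u ⊆ region Λ := by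
    refine (closure_mono fun x hx => ?_).trans hgU
    exact fun h0 => hx (by simp [hu, h0])
  have hL : MemLp u 2 (regionMeasure Λ) := hu1.continuous.memLp_of_hasCompactSupport huc
  have hmem : hL.toLp u ∈ testSpace Λ := ⟨u, hu1, huc, hus, hL.coeFn_toLp⟩
  obtain ⟨hA, -, hD⟩ := isAC2_of_contDiff hΛ hu1 huc hus
  refine ⟨⟨hL.toLp u, testSpace_le_maxDomain Λ hmem⟩, hmem, hL.coeFn_toLp, ?_⟩
  refine (negDeriv2_ae_eq ⟨hL.toLp u, testSpace_le_maxDomain Λ hmem⟩ hA hL.coeFn_toLp).trans ?_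
  filter_upwards [ae_mem_region Λ] with x hx
  have hd : ∀ {f : ℝ → ℝ}, ContDiff ℝ (⊤ : ℕ∞) f →
      deriv (fun x => (f x : ℂ)) = fun x => ((deriv f x : ℝ) : ℂ) := fun hf =>
    funext fun x => ((hf.differentiable (by simp) x).hasDerivAt.ofReal_comp).deriv
  have hg1 : ContDiff ℝ (⊤ : ℕ∞) (deriv g) := by
    have := hg.iterate_deriv 1
    simpa using this
  rw [hD hx, hu, hd hg, hd hg1]

/-- A vector orthogonal to all real test functions integrates to zero against each of them, hence
vanishes almost everywhere. -/
theorem dense_testSpace {Λ : ℝ} (hΛ : 0 < Λ) : Dense (testSpace Λ : Set (L2 Λ)) := by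
  rw [Submodule.dense_iff_topologicalClosure_eq_top, Submodule.topologicalClosure_eq_top_iff,
    Submodule.eq_bot_iff]
  intro ψ hψ
  have hL : LocallyIntegrable ((region Λ).indicator ψ) :=
    (memLp_indicator_region (Lp.memLp ψ)).locallyIntegrable (by norm_num)
  have key := (isOpen_region Λ).ae_eq_zero_of_integral_contDiff_smul_eq_zero (μ := volume)
    (hL.locallyIntegrableOn _) fun g hg hgc hgU => ?_
  · rw [Lp.eq_zero_iff_ae_eq_zero]
    filter_upwards [ae_mem_region Λ, ae_restrict_of_ae key] with x hx h
    have := h hx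
    rwa [indicator_of_mem hx] at this
  · obtain ⟨φ, hφ, hφg, -⟩ := exists_test_class hΛ hg hgc hgU
    have h0 := (Submodule.mem_orthogonal _ _).1 hψ _ hφ
    rw [inner_eq_integral hφg (EventuallyEq.refl _ ψ)] at h0
    have e : (fun x => g x • (region Λ).indicator ψ x) =
        (region Λ).indicator fun x => g x • ψ x := (indicator_smul _ _ _).symm
    rw [e, integral_indicator (isOpen_region Λ).measurableSet]
    simpa [Complex.conj_ofReal, Complex.real_smul] using h0

/-- A weak solution in `L²(Ω_Λ)` lies in the maximal domain. -/
theorem mem_maxDomain_of_inner {Λ : ℝ} (hΛ : 0 < Λ) {ψ χ : L2 Λ}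
    (H : ∀ φ : maxDomain Λ, (φ : L2 Λ) ∈ testSpace Λ →
      inner ℂ χ (φ : L2 Λ) = inner ℂ ψ (negLaplacian Λ φ)) :
    ∃ h : ψ ∈ maxDomain Λ, negLaplacian Λ ⟨ψ, h⟩ = χ := by
  obtain ⟨u, hu, hψu, hD⟩ := exists_isAC2_of_weak_deriv2 hΛ (Lp.memLp ψ) (W := fun x => -χ x)
    (Lp.memLp χ).neg (by
      intro g hg hgc hgU
      obtain ⟨φ, hφ, hφg, hφD⟩ := exists_test_class hΛ hg hgc hgU
      have h := H φ hφ
      -- The real test function is moved to the conjugated slot, where the conjugation has no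
      -- effect.
      rw [← inner_conj_symm, ← inner_conj_symm ψ, inner_eq_integral hφg (EventuallyEq.refl _ χ),
        inner_eq_integral hφD (EventuallyEq.refl _ ψ)] at h
      have h' := (starRingEnd ℂ).injective h
      simp only [map_neg, Complex.conj_ofReal, neg_mul, integral_neg] at h'
      simp only [Complex.real_smul, mul_neg, integral_neg]
      rw [h', neg_neg])
  refine ⟨⟨u, hu, hψu⟩, Lp.ext ?_⟩
  filter_upwards [negDeriv2_ae_eq ⟨ψ, ⟨u, hu, hψu⟩⟩ hu hψu, hD] with x h1 h2
  have : negLaplacian Λ ⟨ψ, ⟨u, hu, hψu⟩⟩ x = -D Λ (D Λ u) x := h1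
  rw [this, h2, neg_neg]

/-! ### Self-adjointness of restrictions of the maximal operator. -/

section Restriction

variable {Λ : ℝ} {S : Submodule ℂ (L2 Λ)}

theorem domain_domRestrict (hS : S ≤ maxDomain Λ) :
    ((negLaplacian Λ).domRestrict S).domain = S := inf_eq_left.2 hS

theorem domRestrict_negLaplacian_apply (hS : S ≤ maxDomain Λ)
    (x : ((negLaplacian Λ).domRestrict S).domain) :
    (negLaplacian Λ).domRestrict S x = negLaplacian Λ ⟨x, hS x.2.1⟩ :=
  LinearPMap.domRestrict_apply rfl

theorem dense_domRestrict (hΛ : 0 < Λ) (hT : testSpace Λ ≤ S) (hS : S ≤ maxDomain Λ) :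
    Dense (((negLaplacian Λ).domRestrict S).domain : Set (L2 Λ)) := by
  rw [domain_domRestrict hS]
  exact (dense_testSpace hΛ).mono hT

/-- The adjoint relation, tested on `testSpace` alone, already makes `ψ` a weak solution. -/
theorem adjoint_domRestrict_le (hΛ : 0 < Λ) (hT : testSpace Λ ≤ S) (hS : S ≤ maxDomain Λ)
    (ψ : ((negLaplacian Λ).domRestrict S).adjoint.domain) :
    ∃ h : (ψ : L2 Λ) ∈ maxDomain Λ,
      negLaplacian Λ ⟨ψ, h⟩ = ((negLaplacian Λ).domRestrict S).adjoint ψ := by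
  refine mem_maxDomain_of_inner hΛ fun φ hφ => ?_
  have := LinearPMap.adjoint_isFormalAdjoint (dense_domRestrict hΛ hT hS) ψ
    ⟨φ, hT hφ, φ.2⟩
  rw [domRestrict_negLaplacian_apply hS] at this
  exact this

/-- A restriction of `-d²/dx²` is self-adjoint when its domain is its own annihilator for the
boundary form. -/
theorem isSelfAdjoint_domRestrict (hΛ : 0 < Λ) (hT : testSpace Λ ≤ S) (hS : S ≤ maxDomain Λ)
    (H : ∀ ψ : maxDomain Λ, (ψ : L2 Λ) ∈ S ↔ ∀ φ : maxDomain Λ, (φ : L2 Λ) ∈ S →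
      inner ℂ (negLaplacian Λ φ) (ψ : L2 Λ) - inner ℂ (φ : L2 Λ) (negLaplacian Λ ψ) = 0) :
    IsSelfAdjoint ((negLaplacian Λ).domRestrict S) := by
  have hd := dense_domRestrict hΛ hT hS
  rw [LinearPMap.isSelfAdjoint_def]
  refine (LinearPMap.eq_of_le_of_domain_eq (LinearPMap.IsFormalAdjoint.le_adjoint hd ?_) ?_).symm
  · intro φ ψ
    rw [domRestrict_negLaplacian_apply hS, domRestrict_negLaplacian_apply hS]
    exact sub_eq_zero.1 ((H ⟨ψ, hS ψ.2.1⟩).1 ψ.2.1 ⟨φ, hS φ.2.1⟩ φ.2.1)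
  · refine le_antisymm (LinearPMap.IsFormalAdjoint.le_adjoint hd ?_).1 fun ψ hψ => ?_
    · intro φ ψ
      rw [domRestrict_negLaplacian_apply hS, domRestrict_negLaplacian_apply hS]
      exact sub_eq_zero.1 ((H ⟨ψ, hS ψ.2.1⟩).1 ψ.2.1 ⟨φ, hS φ.2.1⟩ φ.2.1)
    -- Since the adjoint acts as `negLaplacian`, the adjoint relation says that `ψ` annihilates `S`,
    -- and `H` returns it to `S`.
    · obtain ⟨h, hval⟩ := adjoint_domRestrict_le hΛ hT hS ⟨ψ, hψ⟩
      rw [domain_domRestrict hS]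
      refine (H ⟨ψ, h⟩).2 fun φ hφ => ?_
      have := LinearPMap.adjoint_isFormalAdjoint hd ⟨ψ, hψ⟩ ⟨φ, hφ, φ.2⟩
      rw [domRestrict_negLaplacian_apply hS, ← hval] at this
      rw [sub_eq_zero, ← inner_conj_symm, ← inner_conj_symm (φ : L2 Λ)]
      exact congrArg _ this.symm

end Restriction

/-! ### Adjoint and closure of the minimal operator. -/

theorem inner_negLaplacian_of_zeroData {Λ : ℝ} (hΛ : 0 < Λ) {φ ψ : maxDomain Λ} {u : ℝ → ℂ}
    (hu : IsAC2 Λ u) (hψ : (ψ : L2 Λ) =ᵐ[regionMeasure Λ] u) (h0 : ZeroData Λ u) :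
    inner ℂ (negLaplacian Λ φ) (ψ : L2 Λ) = inner ℂ (φ : L2 Λ) (negLaplacian Λ ψ) := by
  obtain ⟨v, hv, hφ⟩ := φ.2
  rw [← sub_eq_zero, inner_negLaplacian_sub hΛ hv hu hφ hψ, h0.boundaryForm]

theorem H00_apply {Λ : ℝ} (x : (H00 Λ).domain) :
    H00 Λ x = negLaplacian Λ ⟨x, testSpace_le_maxDomain Λ x.2.1⟩ :=
  domRestrict_negLaplacian_apply (testSpace_le_maxDomain Λ) x

/-- One inclusion is Green's formula with vanishing data, the other is regularity of weak solutions.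
As an adjoint, `negLaplacian` is closed. -/
theorem H00_adjoint_eq {Λ : ℝ} (hΛ : 0 < Λ) : (H00 Λ).adjoint = negLaplacian Λ := by
  have hT := testSpace_le_maxDomain Λ
  have hd : Dense ((H00 Λ).domain : Set (L2 Λ)) := dense_domRestrict hΛ le_rfl hT
  have hle : negLaplacian Λ ≤ (H00 Λ).adjoint := by
    refine LinearPMap.IsFormalAdjoint.le_adjoint hd fun φ ψ => ?_
    obtain ⟨u, hu, hφu, h0⟩ := exists_zeroData_of_mem_testSpace hΛ φ.2.1
    have h := inner_negLaplacian_of_zeroData hΛ (φ := ψ) (ψ := ⟨φ, hT φ.2.1⟩) hu hφu h0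
    rw [H00_apply, ← inner_conj_symm, ← inner_conj_symm (φ : L2 Λ)]
    exact congrArg _ h.symm
  refine (LinearPMap.eq_of_le_of_domain_eq hle (le_antisymm hle.1 fun ψ hψ => ?_)).symm
  exact (adjoint_domRestrict_le hΛ le_rfl hT ⟨ψ, hψ⟩).1

theorem isClosed_negLaplacian {Λ : ℝ} (hΛ : 0 < Λ) : (negLaplacian Λ).IsClosed := by
  rw [← H00_adjoint_eq hΛ]
  exact LinearPMap.adjoint_isClosed (dense_domRestrict hΛ le_rfl (testSpace_le_maxDomain Λ))

theorem H00_le_negLaplacian (Λ : ℝ) : H00 Λ ≤ negLaplacian Λ := LinearPMap.domRestrict_le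

/-- The closure of an operator has the closed graph only when the operator is closable; `H00` is,
because it has the closed extension `negLaplacian`. -/
theorem graph_H0 {Λ : ℝ} (hΛ : 0 < Λ) :
    (H0 Λ).graph = (H00 Λ).graph.topologicalClosure :=
  (((isClosed_negLaplacian hΛ).isClosable.leIsClosable
    (H00_le_negLaplacian Λ)).graph_closure_eq_closure_graph).symm

theorem H0_le_of_isClosed {Λ : ℝ} (hΛ : 0 < Λ) {A : L2 Λ →ₗ.[ℂ] L2 Λ} (hA : A.IsClosed)
    (h : H00 Λ ≤ A) : H0 Λ ≤ A := by
  refine LinearPMap.le_of_le_graph ?_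
  rw [graph_H0 hΛ]
  exact Submodule.topologicalClosure_minimal _ (LinearPMap.le_graph_of_le h) hA

/-- The adjoint relation is a closed condition on pairs, so it passes from the graph of `H00` to its
closure. The clause `D(H₀*)` in `alphaDomain` thereby becomes automatic. -/
theorem maxDomain_le_H0_adjoint_domain {Λ : ℝ} (hΛ : 0 < Λ) :
    maxDomain Λ ≤ (H0 Λ).adjoint.domain := by
  intro ψ hψ
  refine LinearPMap.mem_adjoint_domain_of_exists _ ⟨negLaplacian Λ ⟨ψ, hψ⟩, fun x => ?_⟩
  have hx : ((x : L2 Λ), H0 Λ x) ∈ closure ((H00 Λ).graph : Set (L2 Λ × L2 Λ)) := by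
    have := (H0 Λ).mem_graph x
    rwa [graph_H0 hΛ] at this
  have hcl : IsClosed {p : L2 Λ × L2 Λ |
      inner ℂ (negLaplacian Λ ⟨ψ, hψ⟩) p.1 = inner ℂ ψ p.2} :=
    isClosed_eq (by fun_prop) (by fun_prop)
  refine closure_minimal (fun p hp => ?_) hcl hx
  obtain ⟨y, hy1, hy2⟩ := (LinearPMap.mem_graph_iff _).1 hp
  have hT := testSpace_le_maxDomain Λ
  obtain ⟨u, hu, hyu, h0⟩ := exists_zeroData_of_mem_testSpace hΛ y.2.1
  have h := inner_negLaplacian_of_zeroData hΛ (φ := ⟨ψ, hψ⟩) (ψ := ⟨y, hT y.2.1⟩) hu hyu h0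
  rw [mem_ofPred_eq, ← hy1, ← hy2, H00_apply]
  exact h

/-- Functions whose boundary data vanish belong to the domain of the closure `H₀`. -/
theorem mem_H0_domain_of_zeroData {Λ : ℝ} (hΛ : 0 < Λ) {ψ : L2 Λ} {u : ℝ → ℂ}
    (hu : IsAC2 Λ u) (hψ : ψ =ᵐ[regionMeasure Λ] u) (h0 : ZeroData Λ u) :
    ψ ∈ (H0 Λ).domain := by
  have hmem : ψ ∈ maxDomain Λ := ⟨u, hu, hψ⟩
  -- The Hilbert sum makes orthogonal complements available: the closure of the graph is its double
  -- complement.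
  let e := WithLp.prodContinuousLinearEquiv 2 ℂ (L2 Λ) (L2 Λ)
  let K : Submodule ℂ (WithLp 2 (L2 Λ × L2 Λ)) := (H00 Λ).graph.comap e.toLinearMap
  have hz : WithLp.toLp 2 (ψ, negLaplacian Λ ⟨ψ, hmem⟩) ∈ Kᗮᗮ := by
    rw [Submodule.mem_orthogonal]
    intro q hq
    rw [Submodule.mem_orthogonal] at hq
    -- Orthogonality of `q` to the graph says weakly that `-d²/dx²` sends `q.snd` to `-q.fst`.
    -- Green's formula with the vanishing data of `u` then makes `q` orthogonal to the pair built
    -- from `ψ`.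
    obtain ⟨h, hval⟩ := mem_maxDomain_of_inner hΛ (ψ := q.snd) (χ := -q.fst) (by
      intro φ hφ
      have hg : ((φ : L2 Λ), negLaplacian Λ φ) ∈ (H00 Λ).graph := by
        have := (H00 Λ).mem_graph ⟨φ, hφ, φ.2⟩
        rw [H00_apply] at this
        exact this
      have := hq (WithLp.toLp 2 ((φ : L2 Λ), negLaplacian Λ φ)) hg
      rw [← inner_conj_symm, WithLp.prod_inner_apply] at this
      have h2 := (map_eq_zero _).1 this
      simp only [inner_neg_left]
      exact (eq_neg_of_add_eq_zero_right h2).symm)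
    have hG : inner ℂ (-q.fst) ψ = inner ℂ q.snd (negLaplacian Λ ⟨ψ, hmem⟩) := by
      rw [← hval]
      exact inner_negLaplacian_of_zeroData hΛ (φ := ⟨q.snd, h⟩) (ψ := ⟨ψ, hmem⟩) hu hψ h0
    rw [inner_neg_left] at hG
    rw [WithLp.prod_inner_apply]
    change inner ℂ q.fst ψ + inner ℂ q.snd (negLaplacian Λ ⟨ψ, hmem⟩) = 0
    rw [← hG, add_neg_cancel]
  rw [Submodule.orthogonal_orthogonal_eq_closure] at hz
  have hcl : (ψ, negLaplacian Λ ⟨ψ, hmem⟩) ∈ closure ((H00 Λ).graph : Set (L2 Λ × L2 Λ)) :=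
    map_mem_closure (f := e) e.continuous hz fun x hx => hx
  have : (ψ, negLaplacian Λ ⟨ψ, hmem⟩) ∈ (H0 Λ).graph := by
    rw [graph_H0 hΛ]
    exact hcl
  exact LinearPMap.mem_domain_of_mem_graph this

/-! ### Exponentials and prescribed boundary values -/

/-- `A e^{kx}` on the left and `B e^{mx}` on the right. -/
noncomputable def glueExp (A k B m : ℂ) (x : ℝ) : ℂ :=
  if x < 0 then A * Complex.exp (k * x) else B * Complex.exp (m * x)

theorem isDoublePrimitive_exp (A k : ℂ) :
    IsDoublePrimitive (fun x => A * Complex.exp (k * x)) (fun x => A * k * Complex.exp (k * x))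
      (fun x => A * k * k * Complex.exp (k * x)) := by
  have hd : ∀ (C : ℂ) (x : ℝ),
      HasDerivAt (fun x : ℝ => C * Complex.exp (k * x)) (C * k * Complex.exp (k * x)) x := by
    intro C x
    refine (((Complex.ofRealCLM.hasDerivAt (x := x)).const_mul k).cexp.const_mul C).congr_deriv ?_
    simp
    ring
  have h := IsDoublePrimitive.of_contDiff
    (p := fun x : ℝ => A * Complex.exp (k * x)) (by
      exact contDiff_const.mul
        (Complex.contDiff_exp.comp (contDiff_const.mul Complex.ofRealCLM.contDiff)))
  rw [funext fun x => (hd A x).deriv, funext fun x => (hd (A * k) x).deriv] at h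
  exact h

theorem memLp_glueExp {Λ : ℝ} (hΛ : 0 < Λ) {k m : ℂ} (hk : 0 < k.re) (hm : m.re < 0) (A B : ℂ) :
    MemLp (glueExp A k B m) 2 (regionMeasure Λ) := by
  have hmeas : Measurable (glueExp A k B m) :=
    Measurable.ite measurableSet_Iio (by fun_prop) (by fun_prop)
  rw [memLp_two_iff_integrable_sq_norm hmeas.aestronglyMeasurable]
  have hsq : ∀ (C c : ℂ) (x : ℝ), ‖C * Complex.exp (c * x)‖ ^ 2 =
      ‖C‖ ^ 2 * Real.exp (2 * c.re * x) := by
    intro C c x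
    rw [norm_mul, mul_pow, Complex.norm_exp, ← Real.exp_nat_mul]
    congr 2
    simp
    ring
  change IntegrableOn _ (Iio (-Λ) ∪ Ioi Λ)
  refine IntegrableOn.union ?_ ?_
  · have h := (integrableOn_exp_mul_Iic (a := 2 * k.re) (by linarith) (-Λ)).const_mul (‖A‖ ^ 2)
    refine (IntegrableOn.mono_set h Iio_subset_Iic_self).congr_fun (fun x hx => ?_)
      measurableSet_Iio
    simp only [mem_Iio] at hx
    simp only [glueExp]
    rw [if_pos (by linarith), hsq]
  · have h := (integrableOn_exp_mul_Ioi (a := 2 * m.re) (by linarith) Λ).const_mul (‖B‖ ^ 2)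
    refine IntegrableOn.congr_fun h (fun x hx => ?_) measurableSet_Ioi
    simp only [mem_Ioi] at hx
    simp only [glueExp]
    rw [if_neg (by linarith), hsq]

theorem isAC2_glueExp {Λ : ℝ} (hΛ : 0 < Λ) {k m : ℂ} (hk : 0 < k.re) (hm : m.re < 0) (A B : ℂ) :
    IsAC2 Λ (glueExp A k B m) :=
  (isDoublePrimitive_exp A k).isAC2_ite hΛ (isDoublePrimitive_exp B m)
    (memLp_glueExp hΛ hk hm (A * k * k) (B * m * m))

theorem D_glueExp {Λ : ℝ} (hΛ : 0 < Λ) (A k B m : ℂ) :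
    EqOn (D Λ (glueExp A k B m)) (glueExp (A * k) k (B * m) m) (closedRegion Λ) :=
  (isDoublePrimitive_exp A k).D_ite hΛ (isDoublePrimitive_exp B m)

theorem glueExp_neg {Λ : ℝ} (hΛ : 0 < Λ) (A k B m : ℂ) :
    glueExp A k B m (-Λ) = A * Complex.exp (-(k * Λ)) := by
  rw [glueExp, if_pos (by linarith)]
  simp

theorem glueExp_pos {Λ : ℝ} (hΛ : 0 < Λ) (A k B m : ℂ) :
    glueExp A k B m Λ = B * Complex.exp (m * Λ) := by
  rw [glueExp, if_neg (by linarith)]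

theorem exists_boundary_values {Λ : ℝ} (hΛ : 0 < Λ) (a a' b b' : ℂ) :
    ∃ u, IsAC2 Λ u ∧ MemLp u 2 (regionMeasure Λ) ∧ u (-Λ) = a ∧ D Λ u (-Λ) = a' ∧
      u Λ = b ∧ D Λ u Λ = b' := by
  -- With exponents `1, 2` on the left and `-1, -2` on the right, normalised at `±Λ`, the
  -- coefficients solve `A + B = a`, `A + 2B = a'` and `A + B = b`, `-A - 2B = b'`.
  set f := glueExp ((2 * a - a') * Complex.exp Λ) 1 ((2 * b + b') * Complex.exp Λ) (-1) with hf
  set g := glueExp ((a' - a) * Complex.exp (2 * Λ)) 2 (-(b' + b) * Complex.exp (2 * Λ)) (-2)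
    with hg
  have h1 : IsAC2 Λ f := isAC2_glueExp hΛ (by simp) (by simp) _ _
  have h2 : IsAC2 Λ g := isAC2_glueExp hΛ (by simp) (by simp) _ _
  have e1 : Complex.exp (Λ : ℂ) * Complex.exp (-(1 * Λ)) = 1 := by
    rw [← Complex.exp_add]; simp
  have e2 : Complex.exp (2 * (Λ : ℂ)) * Complex.exp (-(2 * Λ)) = 1 := by
    rw [← Complex.exp_add]; simp
  have e3 : Complex.exp (Λ : ℂ) * Complex.exp (-1 * Λ) = 1 := by
    rw [← Complex.exp_add]; simp
  have e4 : Complex.exp (2 * (Λ : ℂ)) * Complex.exp (-2 * Λ) = 1 := by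
    rw [← Complex.exp_add]; simp
  refine ⟨_, h1.add h2, (memLp_glueExp hΛ (by simp) (by simp) _ _).add
    (memLp_glueExp hΛ (by simp) (by simp) _ _), ?_, ?_, ?_, ?_⟩
  · rw [hf, hg, glueExp_neg hΛ, glueExp_neg hΛ]
    linear_combination (2 * a - a') * e1 + (a' - a) * e2
  · rw [← h1.D_add h2 (neg_mem_closedRegion Λ)]
    simp only
    rw [hf, hg, D_glueExp hΛ _ _ _ _ (neg_mem_closedRegion Λ),
      D_glueExp hΛ _ _ _ _ (neg_mem_closedRegion Λ), glueExp_neg hΛ, glueExp_neg hΛ]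
    linear_combination (2 * a - a') * e1 + 2 * (a' - a) * e2
  · rw [hf, hg, glueExp_pos hΛ, glueExp_pos hΛ]
    linear_combination (2 * b + b') * e3 - (b' + b) * e4
  · rw [← h1.D_add h2 (mem_closedRegion Λ)]
    simp only
    rw [hf, hg, D_glueExp hΛ _ _ _ _ (mem_closedRegion Λ),
      D_glueExp hΛ _ _ _ _ (mem_closedRegion Λ), glueExp_pos hΛ, glueExp_pos hΛ]
    linear_combination -(2 * b + b') * e3 + 2 * (b' + b) * e4

/-! ### Coupled boundary conditions define self-adjoint extensions -/

/-- The relations that express that the coupling matrix preserves the boundary form. -/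
theorem ClassA.relations {α₁ α₂ α₃ α₄ : ℂ} (h : ClassA α₁ α₂ α₃ α₄) :
    conj α₁ * α₃ = α₁ * conj α₃ ∧ conj α₂ * α₄ = α₂ * conj α₄ ∧
      conj α₁ * α₄ - α₂ * conj α₃ = 1 := by
  obtain ⟨h1, h2, h3⟩ := h
  have e1 := Complex.conj_eq_iff_im.2 h2
  have e2 := Complex.conj_eq_iff_im.2 h3
  have e3 := congrArg conj h1
  simp only [map_mul, map_sub, map_one, Complex.conj_conj] at e1 e2 e3
  exact ⟨e1, e2, e3⟩

/-- The adjoint relations: the transposed coupling matrix preserves the boundary form as well. -/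
theorem ClassA.relations_transpose {α₁ α₂ α₃ α₄ : ℂ} (h : ClassA α₁ α₂ α₃ α₄) :
    α₁ * conj α₄ - α₂ * conj α₃ = 1 ∧ α₁ * conj α₂ = α₂ * conj α₁ ∧
      α₃ * conj α₄ = α₄ * conj α₃ ∧ α₄ * conj α₁ - α₃ * conj α₂ = 1 := by
  obtain ⟨e1, e2, e3⟩ := h.relations
  have h1 := h.1
  -- The known relations give a left inverse of the coupling matrix. It is also a right inverse, and
  -- the entries of the reversed product are the claims.
  have hM : !![conj α₄, -conj α₂; -conj α₃, conj α₁] * !![α₁, α₂; α₃, α₄] = 1 := by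
    rw [Matrix.mul_fin_two, Matrix.one_fin_two]
    congr 1
    ext i j
    fin_cases i <;> fin_cases j <;> simp
    · linear_combination h1
    · linear_combination -e2
    · linear_combination e1
    · linear_combination e3
  have hN := mul_eq_one_comm.1 hM
  rw [Matrix.mul_fin_two, Matrix.one_fin_two] at hN
  have n1 := congrFun (congrFun hN 0) 0
  have n2 := congrFun (congrFun hN 0) 1
  have n3 := congrFun (congrFun hN 1) 0
  have n4 := congrFun (congrFun hN 1) 1
  simp at n1 n2 n3 n4
  refine ⟨?_, ?_, ?_, ?_⟩
  · linear_combination n1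
  · linear_combination -n2
  · linear_combination n3
  · linear_combination n4

section Alpha

variable {Λ : ℝ} {α₁ α₂ α₃ α₄ : ℂ}

theorem BC.add {u v : ℝ → ℂ} (hu : IsAC2 Λ u) (hv : IsAC2 Λ v)
    (h1 : BC Λ α₁ α₂ α₃ α₄ u) (h2 : BC Λ α₁ α₂ α₃ α₄ v) :
    BC Λ α₁ α₂ α₃ α₄ fun x => u x + v x := by
  rw [BC, ← hu.D_add hv (neg_mem_closedRegion Λ), ← hu.D_add hv (mem_closedRegion Λ)]
  exact ⟨by linear_combination h1.1 + h2.1, by linear_combination h1.2 + h2.2⟩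

theorem BC.smul {u : ℝ → ℂ} (c : ℂ) (hu : IsAC2 Λ u) (h : BC Λ α₁ α₂ α₃ α₄ u) :
    BC Λ α₁ α₂ α₃ α₄ fun x => c * u x := by
  rw [BC, ← hu.D_smul c (neg_mem_closedRegion Λ), ← hu.D_smul c (mem_closedRegion Λ)]
  exact ⟨by linear_combination c * h.1, by linear_combination c * h.2⟩

theorem alphaDomain_le_maxDomain : alphaDomain Λ α₁ α₂ α₃ α₄ ≤ maxDomain Λ :=
  fun _ ⟨_, u, hu, hψ, _⟩ => ⟨u, hu, hψ⟩

theorem mem_alphaDomain (hΛ : 0 < Λ) {ψ : L2 Λ} {u : ℝ → ℂ} (hu : IsAC2 Λ u)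
    (hψ : ψ =ᵐ[regionMeasure Λ] u) (h : BC Λ α₁ α₂ α₃ α₄ u) : ψ ∈ alphaDomain Λ α₁ α₂ α₃ α₄ :=
  ⟨maxDomain_le_H0_adjoint_domain hΛ ⟨u, hu, hψ⟩, u, hu, hψ, h⟩

theorem testSpace_le_alphaDomain (hΛ : 0 < Λ) : testSpace Λ ≤ alphaDomain Λ α₁ α₂ α₃ α₄ := by
  intro φ hφ
  obtain ⟨u, hu, hφu, ⟨h1, h2⟩, h3, h4⟩ := exists_zeroData_of_mem_testSpace hΛ hφ
  exact mem_alphaDomain hΛ hu hφu (by simp [BC, h1, h2, h3, h4])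

theorem boundaryForm_eq_of_BC (hA : ClassA α₁ α₂ α₃ α₄) {u v : ℝ → ℂ}
    (hu : BC Λ α₁ α₂ α₃ α₄ u) (hv : BC Λ α₁ α₂ α₃ α₄ v) :
    boundaryForm Λ u v (-Λ) - boundaryForm Λ u v Λ = 0 := by
  obtain ⟨e1, e2, e3⟩ := hA.relations
  have e4 := hA.1
  rw [boundaryForm, boundaryForm, hu.1, hu.2, hv.1, hv.2]
  simp only [map_add, map_mul]
  linear_combination (-conj (u (-Λ)) * v (-Λ)) * e1 - (conj (D Λ u (-Λ)) * D Λ v (-Λ)) * e2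
    - (conj (u (-Λ)) * D Λ v (-Λ)) * e3 + (conj (D Λ u (-Λ)) * v (-Λ)) * e4

theorem isSelfAdjoint_Halpha (hΛ : 0 < Λ) (hA : ClassA α₁ α₂ α₃ α₄) :
    IsSelfAdjoint (Halpha Λ α₁ α₂ α₃ α₄) := by
  refine isSelfAdjoint_domRestrict hΛ (testSpace_le_alphaDomain hΛ) alphaDomain_le_maxDomain
    fun ψ => ⟨?_, fun H => ?_⟩
  · rintro ⟨-, v, hv, hψ, hvB⟩ φ ⟨-, u, hu, hφ, huB⟩
    rw [inner_negLaplacian_sub hΛ hu hv hφ hψ, boundaryForm_eq_of_BC hA huB hvB]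
  · obtain ⟨v, hv, hψ⟩ := ψ.2
    -- `ψ` is tested against functions with arbitrary data at `-Λ`. The two basis choices express
    -- the data of `v` at `-Λ` through those at `Λ`; the transposed relations invert this.
    have key : ∀ a a' : ℂ, conj a * D Λ v (-Λ) - conj a' * v (-Λ) -
        (conj (α₁ * a + α₂ * a') * D Λ v Λ - conj (α₃ * a + α₄ * a') * v Λ) = 0 := by
      intro a a'
      obtain ⟨u, hu, hL, u1, u2, u3, u4⟩ := exists_boundary_values hΛ a a'
        (α₁ * a + α₂ * a') (α₃ * a + α₄ * a')
      have huB : BC Λ α₁ α₂ α₃ α₄ u := by rw [BC, u1, u2, u3, u4]; exact ⟨rfl, rfl⟩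
      have h := H ⟨hL.toLp u, ⟨u, hu, hL.coeFn_toLp⟩⟩ (mem_alphaDomain hΛ hu hL.coeFn_toLp huB)
      rw [inner_negLaplacian_sub hΛ hu hv hL.coeFn_toLp hψ, boundaryForm, boundaryForm, u1, u2,
        u3, u4] at h
      exact h
    have k1 := key 1 0
    have k2 := key 0 1
    simp only [map_one, map_zero, mul_one, mul_zero, add_zero, zero_add, one_mul, zero_mul,
      sub_zero, zero_sub] at k1 k2
    obtain ⟨t1, t2, t3, t4⟩ := hA.relations_transpose
    refine mem_alphaDomain hΛ hv hψ ⟨?_, ?_⟩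
    · linear_combination (-v Λ) * t1 + (D Λ v Λ) * t2 - α₂ * k1 + α₁ * k2
    · linear_combination (-v Λ) * t3 - (D Λ v Λ) * t4 - α₄ * k1 + α₃ * k2

theorem isSelfAdjointExtension_Halpha (hΛ : 0 < Λ) (hA : ClassA α₁ α₂ α₃ α₄) :
    IsSelfAdjointExtension (H0 Λ) (Halpha Λ α₁ α₂ α₃ α₄) := by
  have hs := isSelfAdjoint_Halpha hΛ hA
  -- A self-adjoint operator is closed, so containing `H00` suffices.
  refine ⟨H0_le_of_isClosed hΛ hs.isClosed ⟨?_, fun x y hxy => ?_⟩, hs⟩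
  · exact inf_le_inf_right _ (testSpace_le_alphaDomain hΛ)
  · rw [H00_apply]
    exact (congrArg (negLaplacian Λ) (Subtype.ext hxy)).trans
      (domRestrict_negLaplacian_apply alphaDomain_le_maxDomain y).symm

end Alpha

/-! ### The system `𝒮` -/

theorem phase_add (s t : ℝ) : phase (s + t) = phase s * phase t := by
  rw [phase, phase, phase, ← Complex.exp_add]
  congr 1
  push_cast
  ring

theorem phase_neg (t : ℝ) : phase (-t) = (phase t)⁻¹ := by
  rw [phase, phase, ← Complex.exp_neg]
  congr 1
  push_cast
  ring

theorem phase_ne_zero (t : ℝ) : phase t ≠ 0 := Complex.exp_ne_zero _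

theorem norm_phase (t : ℝ) : ‖phase t‖ = 1 := Complex.norm_exp_ofReal_mul_I t

theorem phase_eq (t : ℝ) : phase t = Real.cos t + Real.sin t * Complex.I := by
  rw [phase, Complex.exp_mul_I, Complex.ofReal_cos, Complex.ofReal_sin]

theorem phase_pi_div_four :
    phase (Real.pi / 4) = (1 + Complex.I) / (√2 : ℝ) := by
  have h : ((√2 : ℝ) : ℂ) ≠ 0 := by simp
  have h2 : ((√2 : ℝ) : ℂ) ^ 2 = 2 := by norm_cast; simp
  rw [phase_eq, Real.cos_pi_div_four, Real.sin_pi_div_four]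
  push_cast
  field_simp
  linear_combination (1 + Complex.I) * h2

theorem phase_neg_pi_div_four :
    phase (-(Real.pi / 4)) = (1 - Complex.I) / (√2 : ℝ) := by
  have h : ((√2 : ℝ) : ℂ) ≠ 0 := by simp
  have h2 : ((√2 : ℝ) : ℂ) ^ 2 = 2 := by norm_cast; simp
  rw [phase_eq, Real.cos_neg, Real.sin_neg, Real.cos_pi_div_four, Real.sin_pi_div_four]
  push_cast
  field_simp
  linear_combination (1 - Complex.I) * h2

theorem phase_three_pi_div_four :
    phase (3 * Real.pi / 4) = (-1 + Complex.I) / (√2 : ℝ) := by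
  have e : 3 * Real.pi / 4 = Real.pi - Real.pi / 4 := by ring
  have h : ((√2 : ℝ) : ℂ) ≠ 0 := by simp
  have h2 : ((√2 : ℝ) : ℂ) ^ 2 = 2 := by norm_cast; simp
  rw [phase_eq, e, Real.cos_pi_sub, Real.sin_pi_sub, Real.cos_pi_div_four, Real.sin_pi_div_four]
  push_cast
  field_simp
  linear_combination (-1 + Complex.I) * h2

theorem phase_neg_three_pi_div_four :
    phase (-(3 * Real.pi / 4)) = (-1 - Complex.I) / (√2 : ℝ) := by
  have e : 3 * Real.pi / 4 = Real.pi - Real.pi / 4 := by ring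
  have h : ((√2 : ℝ) : ℂ) ≠ 0 := by simp
  have h2 : ((√2 : ℝ) : ℂ) ^ 2 = 2 := by norm_cast; simp
  rw [phase_eq, Real.cos_neg, Real.sin_neg, e, Real.cos_pi_sub, Real.sin_pi_sub,
    Real.cos_pi_div_four, Real.sin_pi_div_four]
  push_cast
  field_simp
  linear_combination (-1 - Complex.I) * h2

/-- The two linear equations of the system determine `α₃` and `α₄`. -/
theorem SystemS.eq_of_linear {G : ℂ → ℂ → ℂ} {α₁ α₂ α₃ α₄ : ℂ} (h : SystemS G α₁ α₂ α₃ α₄) :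
    α₄ = α₁ ∧ α₃ = -(√2 : ℝ) * α₁ - α₂ := by
  obtain ⟨-, h1, h2⟩ := h
  rw [phase_neg_pi_div_four, phase_three_pi_div_four] at h1
  rw [phase_pi_div_four, phase_neg_three_pi_div_four] at h2
  have h : ((√2 : ℝ) : ℂ) ≠ 0 := by simp
  have hs : ((√2 : ℝ) : ℂ) ^ 2 = 2 := by norm_cast; simp
  have hI := Complex.I_sq
  set s : ℂ := ((√2 : ℝ) : ℂ)
  field_simp at h1 h2
  -- In the sum of the two equations the `α₄` terms cancel, since `(1 - i)(-1 + i) = 2i` and `(1 +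
  -- i)(-1 - i) = -2i`. The difference then yields `α₄`.
  have e1 : α₃ = -s * α₁ - α₂ := by
    refine mul_left_cancel₀ h ?_
    linear_combination (1 / 2 : ℂ) * h1 + (1 / 2 : ℂ) * h2 - α₄ * hI
  refine ⟨mul_left_cancel₀ Complex.I_ne_zero ?_, e1⟩
  linear_combination (1 / 4 : ℂ) * h2 - (1 / 4 : ℂ) * h1 - (Complex.I * s / 2) * e1
    + (Complex.I * α₁ / 2) * hs

/-- The common modulus computation behind `|γ_→| = |γ_←| = 1`. -/
theorem norm_add_mul_phase {α₁ α₂ α₃ α₄ : ℂ} (hA : ClassA α₁ α₂ α₃ α₄) (h4 : α₄ = α₁)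
    (h3 : α₃ = -(√2 : ℝ) * α₁ - α₂) :
    ‖α₁ + α₂ * phase (-(Real.pi / 4))‖ = 1 ∧ ‖α₁ + α₂ * phase (Real.pi / 4)‖ = 1 := by
  -- As `α₁ conj α₂` is real, both squared moduli equal `|α₁|² + √2 α₁ conj α₂ + |α₂|²`, which is
  -- the left side of the first `ClassA` relation after substitution.
  have hr := hA.relations_transpose.2.1
  have h1 := hA.1
  rw [h4, h3] at h1
  have h : ((√2 : ℝ) : ℂ) ≠ 0 := by simp
  have hs : ((√2 : ℝ) : ℂ) ^ 2 = 2 := by norm_cast; simp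
  have hI := Complex.I_sq
  have key : ∀ z : ℂ, z * conj z = 1 → ‖z‖ = 1 := fun z hz => by
    rw [Complex.mul_conj, Complex.normSq_eq_norm_sq] at hz
    have : ‖z‖ ^ 2 = 1 := by exact_mod_cast hz
    exact (pow_eq_one_iff_of_nonneg (norm_nonneg z) two_ne_zero).1 this
  have hsr : ((√2 : ℝ) : ℂ) * ((√2 : ℝ) : ℂ)⁻¹ = 1 := mul_inv_cancel₀ h
  rw [phase_neg_pi_div_four, phase_pi_div_four]
  constructor <;> apply key <;>
    simp only [div_eq_mul_inv, map_add, map_mul, map_sub, map_one, map_inv₀, Complex.conj_I,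
      Complex.conj_ofReal]
  all_goals
    set s : ℂ := ((√2 : ℝ) : ℂ)
    set r : ℂ := s⁻¹
    have hs2 : s = 2 * r := by linear_combination (-s) * hsr + r * hs
    have hr2 : 2 * r ^ 2 = 1 := by linear_combination hsr - r * hs2
  · linear_combination h1 - (1 - Complex.I) * r * hr - α₁ * conj α₂ * hs2
      - α₂ * conj α₂ * r ^ 2 * hI + α₂ * conj α₂ * hr2
  · linear_combination h1 - (1 + Complex.I) * r * hr - α₁ * conj α₂ * hs2
      - α₂ * conj α₂ * r ^ 2 * hI + α₂ * conj α₂ * hr2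

/-! ### The extension `H_γ` -/

section Gamma

variable {Λ : ℝ} {α₁ α₂ α₃ α₄ γr γl : ℂ}

theorem normFactor_ne_zero (Λ : ℝ) : (normFactor Λ : ℂ) ≠ 0 := by
  have : 0 < normFactor Λ := by unfold normFactor; positivity
  exact_mod_cast this.ne'

/-- The deficiency combination `L₊ + γ_→ R₋`, extended up to the boundary. -/
noncomputable def leftWave (Λ : ℝ) (γr : ℂ) : ℝ → ℂ :=
  glueExp (normFactor Λ) (phase (-(Real.pi / 4))) (normFactor Λ * γr)
    (phase (-(3 * Real.pi / 4)))

/-- The deficiency combination `R₊ + γ_← L₋`, extended up to the boundary. -/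
noncomputable def rightWave (Λ : ℝ) (γl : ℂ) : ℝ → ℂ :=
  glueExp (normFactor Λ * γl) (phase (Real.pi / 4)) (normFactor Λ) (phase (3 * Real.pi / 4))

theorem phase_re (t : ℝ) : (phase t).re = Real.cos t := Complex.exp_ofReal_mul_I_re t

theorem phase_re_pos : 0 < (phase (Real.pi / 4)).re ∧ 0 < (phase (-(Real.pi / 4))).re := by
  rw [phase_re, phase_re, Real.cos_neg, Real.cos_pi_div_four]
  exact ⟨by positivity, by positivity⟩

theorem phase_re_neg :
    (phase (3 * Real.pi / 4)).re < 0 ∧ (phase (-(3 * Real.pi / 4))).re < 0 := by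
  rw [phase_re, phase_re, Real.cos_neg, show 3 * Real.pi / 4 = Real.pi - Real.pi / 4 by ring,
    Real.cos_pi_sub, Real.cos_pi_div_four]
  exact ⟨by rw [neg_lt_zero]; positivity, by rw [neg_lt_zero]; positivity⟩

theorem isAC2_leftWave (hΛ : 0 < Λ) (γr : ℂ) :
    IsAC2 Λ (leftWave Λ γr) ∧ MemLp (leftWave Λ γr) 2 (regionMeasure Λ) :=
  ⟨isAC2_glueExp hΛ phase_re_pos.2 phase_re_neg.2 _ _,
    memLp_glueExp hΛ phase_re_pos.2 phase_re_neg.2 _ _⟩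

theorem isAC2_rightWave (hΛ : 0 < Λ) (γl : ℂ) :
    IsAC2 Λ (rightWave Λ γl) ∧ MemLp (rightWave Λ γl) 2 (regionMeasure Λ) :=
  ⟨isAC2_glueExp hΛ phase_re_pos.1 phase_re_neg.1 _ _,
    memLp_glueExp hΛ phase_re_pos.1 phase_re_neg.1 _ _⟩

/-- `Lplus` and `Rminus` take the value `0` at `±Λ` because their inequalities are strict, so
one-sided boundary values must be read from the glued exponential. -/
theorem leftWave_eq (hΛ : 0 < Λ) (γr : ℂ) {x : ℝ} (hx : x ∈ region Λ) :
    Lplus Λ x + γr * Rminus Λ x = leftWave Λ γr x := by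
  rw [leftWave, glueExp, phase_neg_pi_div_four, phase_neg_three_pi_div_four, Lplus, Rminus]
  rcases hx with hx | hx
  · simp only [mem_Iio] at hx
    rw [if_pos hx, if_neg (by linarith), if_pos (by linarith), mul_zero, add_zero, mul_div_right_comm]
  · simp only [mem_Ioi] at hx
    rw [if_neg (by linarith), if_pos hx, if_neg (by linarith), zero_add, mul_div_right_comm]
    ring

theorem rightWave_eq (hΛ : 0 < Λ) (γl : ℂ) {x : ℝ} (hx : x ∈ region Λ) :
    Rplus Λ x + γl * Lminus Λ x = rightWave Λ γl x := by
  rw [rightWave, glueExp, phase_pi_div_four, phase_three_pi_div_four, Rplus, Lminus]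
  rcases hx with hx | hx
  · simp only [mem_Iio] at hx
    rw [if_neg (by linarith), if_pos hx, if_pos (by linarith), zero_add, mul_div_right_comm]
    ring
  · simp only [mem_Ioi] at hx
    rw [if_pos hx, if_neg (by linarith), if_neg (by linarith), mul_zero, add_zero,
      mul_div_right_comm]

/-- The factor `e^{i√2Λ}` is the ratio of the boundary values of the exponentials at `±Λ`. -/
theorem phase_mul_exp_leftWave (Λ : ℝ) :
    phase (√2 * Λ) * Complex.exp (phase (-(3 * Real.pi / 4)) * Λ) =
      Complex.exp (-(phase (-(Real.pi / 4)) * Λ)) := by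
  have h : ((√2 : ℝ) : ℂ) ≠ 0 := by simp
  have hs : ((√2 : ℝ) : ℂ) ^ 2 = 2 := by norm_cast; simp
  rw [phase_neg_pi_div_four, phase_neg_three_pi_div_four, phase, ← Complex.exp_add]
  congr 1
  push_cast
  field_simp
  linear_combination Λ * Complex.I * hs

theorem phase_mul_exp_rightWave (Λ : ℝ) :
    phase (√2 * Λ) * Complex.exp (-(phase (Real.pi / 4) * Λ)) =
      Complex.exp (phase (3 * Real.pi / 4) * Λ) := by
  have h : ((√2 : ℝ) : ℂ) ≠ 0 := by simp
  have hs : ((√2 : ℝ) : ℂ) ^ 2 = 2 := by norm_cast; simp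
  rw [phase_pi_div_four, phase_three_pi_div_four, phase, ← Complex.exp_add]
  congr 1
  push_cast
  field_simp
  linear_combination Λ * Complex.I * hs

/-- Differentiation multiplies the branches by `phase (-(π/4))` and `phase (-(3π/4))`. The two
boundary conditions thus become the two formulas for `γr`, up to common factors. -/
theorem BC_leftWave (hΛ : 0 < Λ)
    (h1 : γr = (α₁ + α₂ * phase (-(Real.pi / 4))) * phase (√2 * Λ))
    (h2 : γr = (α₃ + α₄ * phase (-(Real.pi / 4))) * phase (√2 * Λ + 3 * Real.pi / 4)) :
    BC Λ α₁ α₂ α₃ α₄ (leftWave Λ γr) := by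
  have hE := phase_mul_exp_leftWave Λ
  have hp : phase (3 * Real.pi / 4) * phase (-(3 * Real.pi / 4)) = 1 := by
    rw [phase_neg, mul_inv_cancel₀ (phase_ne_zero _)]
  rw [phase_add] at h2
  rw [BC, leftWave, D_glueExp hΛ _ _ _ _ (neg_mem_closedRegion Λ),
    D_glueExp hΛ _ _ _ _ (mem_closedRegion Λ), glueExp_neg hΛ, glueExp_neg hΛ, glueExp_pos hΛ,
    glueExp_pos hΛ, ← hE]
  set E := Complex.exp (phase (-(3 * Real.pi / 4)) * Λ)
  constructor
  · linear_combination (normFactor Λ * E) * h1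
  · linear_combination (normFactor Λ * phase (-(3 * Real.pi / 4)) * E) * h2 +
      (normFactor Λ * E * (α₃ + α₄ * phase (-(Real.pi / 4))) * phase (√2 * Λ)) * hp

theorem BC_rightWave (hΛ : 0 < Λ)
    (h1 : γl * (α₁ + α₂ * phase (Real.pi / 4)) = phase (√2 * Λ))
    (h2 : γl * (α₃ + α₄ * phase (Real.pi / 4)) = phase (√2 * Λ + 3 * Real.pi / 4)) :
    BC Λ α₁ α₂ α₃ α₄ (rightWave Λ γl) := by
  have hE := phase_mul_exp_rightWave Λ
  rw [phase_add] at h2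
  rw [BC, rightWave, D_glueExp hΛ _ _ _ _ (neg_mem_closedRegion Λ),
    D_glueExp hΛ _ _ _ _ (mem_closedRegion Λ), glueExp_neg hΛ, glueExp_neg hΛ, glueExp_pos hΛ,
    glueExp_pos hΛ, ← hE]
  set E := Complex.exp (-(phase (Real.pi / 4) * Λ))
  constructor
  · linear_combination (-(normFactor Λ * E)) * h1
  · linear_combination (-(normFactor Λ * E)) * h2

/-- The two waves span the boundary data at `-Λ`. -/
theorem exists_wave_coefficients (hΛ : 0 < Λ) (hγ : γl ≠ 0) (a a' : ℂ) :
    ∃ c d : ℂ, c * leftWave Λ γr (-Λ) + d * rightWave Λ γl (-Λ) = a ∧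
      c * D Λ (leftWave Λ γr) (-Λ) + d * D Λ (rightWave Λ γl) (-Λ) = a' := by
  rw [leftWave, rightWave, D_glueExp hΛ _ _ _ _ (neg_mem_closedRegion Λ),
    D_glueExp hΛ _ _ _ _ (neg_mem_closedRegion Λ), glueExp_neg hΛ, glueExp_neg hΛ,
    glueExp_neg hΛ, glueExp_neg hΛ]
  have hN := normFactor_ne_zero Λ
  have hE₁ := Complex.exp_ne_zero (-(phase (-(Real.pi / 4)) * Λ))
  have hE₂ := Complex.exp_ne_zero (-(phase (Real.pi / 4) * Λ))
  have hw : phase (Real.pi / 4) - phase (-(Real.pi / 4)) ≠ 0 := by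
    rw [phase_pi_div_four, phase_neg_pi_div_four, ← sub_div]
    simp [Complex.ext_iff]
  set E₁ := Complex.exp (-(phase (-(Real.pi / 4)) * Λ))
  set E₂ := Complex.exp (-(phase (Real.pi / 4) * Λ))
  set w := phase (Real.pi / 4)
  set w' := phase (-(Real.pi / 4))
  -- Cramer's rule for the Vandermonde system with nodes `w'` and `w`, followed by division by the
  -- amplitudes of the waves at `-Λ`.
  refine ⟨(w * a - a') / (w - w') / (normFactor Λ * E₁),
    (a' - w' * a) / (w - w') / (normFactor Λ * γl * E₂), ?_, ?_⟩
  · field_simp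
    ring
  · field_simp
    ring

theorem waves_mem_alphaDomain (hΛ : 0 < Λ) {u : ℝ → ℂ}
    (hu : IsAC2 Λ u ∧ MemLp u 2 (regionMeasure Λ)) (hB : BC Λ α₁ α₂ α₃ α₄ u) :
    hu.2.toLp u ∈ alphaDomain Λ α₁ α₂ α₃ α₄ :=
  mem_alphaDomain hΛ hu.1 hu.2.coeFn_toLp hB

theorem alphaDomain_eq_gammaDomain (hΛ : 0 < Λ) (hA : ClassA α₁ α₂ α₃ α₄) (hγ : γl ≠ 0)
    (hL : BC Λ α₁ α₂ α₃ α₄ (leftWave Λ γr)) (hR : BC Λ α₁ α₂ α₃ α₄ (rightWave Λ γl)) :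
    alphaDomain Λ α₁ α₂ α₃ α₄ = gammaDomain Λ γr γl := by
  have aL := isAC2_leftWave hΛ γr
  have aR := isAC2_rightWave hΛ γl
  have mL := waves_mem_alphaDomain hΛ aL hL
  have mR := waves_mem_alphaDomain hΛ aR hR
  apply le_antisymm
  · rintro ψ ⟨-, v, hv, hψ, hvB⟩
    -- The combination matches the data of `v` at `-Λ`. The remainder has zero data there and still
    -- satisfies the boundary condition, so its data at `Λ` vanish too.
    obtain ⟨c, d, h1, h2⟩ := exists_wave_coefficients (γr := γr) hΛ hγ (v (-Λ)) (D Λ v (-Λ))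
    have b1 := (aL.1.smul (-c)).add (aR.1.smul (-d))
    have hB := hvB.add hv b1 ((hL.smul (-c) aL.1).add (aL.1.smul (-c)) (aR.1.smul (-d))
      (hR.smul (-d) aR.1))
    set r : ℝ → ℂ := fun x => v x + (-c * leftWave Λ γr x + -d * rightWave Λ γl x) with hr
    have hrA : IsAC2 Λ r := hv.add b1
    have z1 : r (-Λ) = 0 := by rw [hr]; linear_combination -h1
    have z2 : D Λ r (-Λ) = 0 := by
      have e1 := hv.D_add b1 (neg_mem_closedRegion Λ)
      have e2 := (aL.1.smul (-c)).D_add (aR.1.smul (-d)) (neg_mem_closedRegion Λ)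
      have e3 := aL.1.D_smul (-c) (neg_mem_closedRegion Λ)
      have e4 := aR.1.D_smul (-d) (neg_mem_closedRegion Λ)
      simp only at e1 e2 e3 e4
      rw [hr, ← e1, ← e2, ← e3, ← e4]
      linear_combination -h2
    have hz : ZeroData Λ r := by
      refine ⟨⟨z1, z2⟩, ?_, ?_⟩
      · rw [hB.1, z1, z2]; ring
      · rw [hB.2, z1, z2]; ring
    have hψr : (ψ - c • aL.2.toLp _ - d • aR.2.toLp _ : L2 Λ) =ᵐ[regionMeasure Λ] r := by
      filter_upwards [hψ, aL.2.coeFn_toLp, aR.2.coeFn_toLp,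
        Lp.coeFn_sub (ψ - c • aL.2.toLp _ : L2 Λ) (d • aR.2.toLp _),
        Lp.coeFn_sub ψ (c • aL.2.toLp _), Lp.coeFn_smul c (aL.2.toLp _),
        Lp.coeFn_smul d (aR.2.toLp _)] with x k1 k2 k3 k4 k5 k6 k7
      rw [k4, Pi.sub_apply, k5, Pi.sub_apply, k6, k7, Pi.smul_apply, Pi.smul_apply, k1, k2, k3,
        smul_eq_mul, smul_eq_mul]
      ring
    refine ⟨_, mem_H0_domain_of_zeroData hΛ hrA hψr hz, c, d, ?_⟩
    filter_upwards [hψ, hψr, ae_mem_region Λ] with x k1 k2 hx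
    rw [k2, k1, leftWave_eq hΛ γr hx, rightWave_eq hΛ γl hx]
    simp only [hr]
    ring
  · rintro ψ ⟨ψ₀, hψ₀, c, d, hψ⟩
    have h0 : ψ₀ ∈ alphaDomain Λ α₁ α₂ α₃ α₄ :=
      ((isSelfAdjointExtension_Halpha hΛ hA).1.1 hψ₀).1
    have : ψ = ψ₀ + c • aL.2.toLp _ + d • aR.2.toLp _ := by
      apply Lp.ext
      filter_upwards [hψ, ae_mem_region Λ, aL.2.coeFn_toLp, aR.2.coeFn_toLp,
        Lp.coeFn_add (ψ₀ + c • aL.2.toLp _ : L2 Λ) (d • aR.2.toLp _),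
        Lp.coeFn_add ψ₀ (c • aL.2.toLp _), Lp.coeFn_smul c (aL.2.toLp _),
        Lp.coeFn_smul d (aR.2.toLp _)] with x k1 hx k2 k3 k4 k5 k6 k7
      rw [k4, Pi.add_apply, k5, Pi.add_apply, k6, k7, Pi.smul_apply, Pi.smul_apply, k1, k2, k3,
        leftWave_eq hΛ γr hx, rightWave_eq hΛ γl hx, smul_eq_mul, smul_eq_mul]
    rw [this]
    exact add_mem (add_mem h0 (Submodule.smul_mem _ c mL)) (Submodule.smul_mem _ d mR)

end Gamma

end Junction

/-! ### Assembly of both parts of the theorem. -/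

theorem mainTheorem3 (Λ : ℝ) (hΛ : 0 < Λ) (α₁ α₂ α₃ α₄ : ℂ)
    (hA : Junction.ClassA α₁ α₂ α₃ α₄) :
    Junction.IsSelfAdjointExtension (Junction.H0 Λ) (Junction.Halpha Λ α₁ α₂ α₃ α₄) ∧
    ((Junction.SystemS Junction.F α₁ α₂ α₃ α₄ ∨
        Junction.SystemS Junction.Fconj α₁ α₂ α₃ α₄) →
      ∀ γr γl : ℂ,
        γr = (α₁ + α₂ * Junction.phase (-(Real.pi / 4))) * Junction.phase (√2 * Λ) →
        γl = (α₁ + α₂ * Junction.phase (Real.pi / 4))⁻¹ * Junction.phase (√2 * Λ) →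
        γr = (α₃ + α₄ * Junction.phase (-(Real.pi / 4))) *
            Junction.phase (√2 * Λ + 3 * Real.pi / 4) ∧
        γl = (α₃ + α₄ * Junction.phase (Real.pi / 4))⁻¹ *
            Junction.phase (√2 * Λ + 3 * Real.pi / 4) ∧
        ‖γr‖ = 1 ∧ ‖γl‖ = 1 ∧
        (Junction.Hgamma Λ γr γl).domain = Junction.gammaDomain Λ γr γl ∧
        Junction.IsSelfAdjointExtension (Junction.H0 Λ) (Junction.Hgamma Λ γr γl) ∧
        Junction.Halpha Λ α₁ α₂ α₃ α₄ = Junction.Hgamma Λ γr γl) := by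
  refine ⟨Junction.isSelfAdjointExtension_Halpha hΛ hA, fun hS γr γl hr hl => ?_⟩
  obtain ⟨h4, h3⟩ : α₄ = α₁ ∧ α₃ = -(√2 : ℝ) * α₁ - α₂ :=
    hS.elim (fun h => h.eq_of_linear) fun h => h.eq_of_linear
  obtain ⟨s1, s2⟩ := hS.elim (fun h => h.2) fun h => h.2
  obtain ⟨n1, n2⟩ := Junction.norm_add_mul_phase hA h4 h3
  have ne : α₁ + α₂ * Junction.phase (Real.pi / 4) ≠ 0 := by
    rw [← norm_ne_zero_iff, n2]
    exact one_ne_zero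
  have ne' : α₃ + α₄ * Junction.phase (Real.pi / 4) ≠ 0 := by
    intro h
    rw [h, zero_mul] at s2
    exact ne s2
  have r2 : γr = (α₃ + α₄ * Junction.phase (-(Real.pi / 4))) *
      Junction.phase (√2 * Λ + 3 * Real.pi / 4) := by
    rw [hr, s1, Junction.phase_add]
    ring
  have l2 : γl = (α₃ + α₄ * Junction.phase (Real.pi / 4))⁻¹ *
      Junction.phase (√2 * Λ + 3 * Real.pi / 4) := by
    rw [hl, s2, Junction.phase_add, Junction.phase_neg, mul_inv, inv_inv]
    ring
  have nr : ‖γr‖ = 1 := by rw [hr, norm_mul, n1, Junction.norm_phase, one_mul]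
  have nl : ‖γl‖ = 1 := by
    rw [hl, norm_mul, norm_inv, n2, Junction.norm_phase, inv_one, one_mul]
  have hγ : γl ≠ 0 := by
    rw [← norm_ne_zero_iff, nl]
    exact one_ne_zero
  have hdom := Junction.alphaDomain_eq_gammaDomain hΛ hA hγ (Junction.BC_leftWave hΛ hr r2)
    (Junction.BC_rightWave hΛ
      (by rw [hl, mul_right_comm, inv_mul_cancel₀ ne, one_mul])
      (by rw [l2, mul_right_comm, inv_mul_cancel₀ ne', one_mul]))
  have hH : Junction.Halpha Λ α₁ α₂ α₃ α₄ = Junction.Hgamma Λ γr γl := by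
    rw [Junction.Halpha, Junction.Hgamma, hdom]
  refine ⟨r2, l2, nr, nl, ?_, hH ▸ Junction.isSelfAdjointExtension_Halpha hΛ hA, hH⟩
  -- `domRestrict` intersects with the maximal domain; nothing is lost, because `gammaDomain` equals
  -- `alphaDomain`.
  exact Junction.domain_domRestrict (hdom ▸ Junction.alphaDomain_le_maxDomain)
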